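/- **Setting.** Indices run over $0,1,2,3$, repeated indices are summed, $\eta=\mathrm{diag}(-1,1,1,1)$. Let $\hbar,m,q$ be real with $\hbar,m\ne0$, let $A_a$ be smooth real functions on $\mathbb R^4$, $F_{ab}=A_{b,a}-A_{a,b}$ (a comma denotes partial derivatives) and $D_a=\partial_a-\imath\frac q\hbar A_a$. Fix a unital algebra $\mathcal F$ of smooth complex functions on $\mathbb R^4$ that contains the coordinates $x^a$ and the $F_{ab}$ and is closed under partial derivatives (for instance $C^\infty(\mathbb R^4)$). The electromagnetic Heisenberg algebra $A$ is the complex algebra generated by $\mathcal F$ and $p_0,\dots,p_3$ with $[f,p_a]=\imath\hbar f_{,a}$ for $f\in\mathcal F$ (so $[x^a,p_b]=\imath\hbar\delta^a{}_b$) and $[p_a,p_b]=\imath\hbar qF_{ab}$. Its calculus $(\Omega^1_A,\mathrm d)$ is the universal first order differential calculus with an additional central 1-form $\theta'$ subject to, for $f\in\mathcal F$, $$\mathrm df=f_{,a}\mathrm dx^a-\tfrac{\imath\hbar}{2m}\eta^{ab}f_{,ab}\theta',\qquad [\mathrm dx^a,f]=-\tfrac{\imath\hbar}m\eta^{ab}f_{,b}\theta',\qquad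 [\mathrm dp_c,f]=\tfrac{\imath\hbar q}m\eta^{ab}F_{bc}f_{,a}\theta',$$ $$[\mathrm dx^a,p_c]=\tfrac{\imath\hbar q}m\eta^{ab}F_{bc}\theta',\qquad [\mathrm dp_c,p_d]=-\imath\hbar qF_{ac,d}\mathrm dx^a-\tfrac{\hbar q}{2m}\eta^{ab}(\hbar F_{bc,ad}+2\imath qF_{ac}F_{bd})\theta'.$$ For algebras $A,B$ with calculi, a right $A$-$B$-bimodule connection on an $A$-$B$-bimodule $E$ is a linear map $\nabla_E:E\to E\otimes_B\Omega^1_B$ together with a bimodule map $\sigma_E:\Omega^1_A\otimes_AE\to E\otimes_B\Omega^1_B$ such that $\nabla_E(e b)=\nabla_E(e)b+e\otimes\mathrm db$ and $\nabla_E(ae)=a\nabla_E(e)+\sigma_E(\mathrm da\otimes e)$. Tensor products carry the connection $\nabla_{E\otimes F}=(\mathrm{id}\otimes\sigma_F)(\nabla_E\otimes\mathrm{id})+\mathrm{id}\otimes\nabla_F$. Given connections on $\Omega^1_A,\Omega^1_B,E$, put $\nabla\!\!\!\!\nabla(\sigma_E)=\nabla_{E\otimes_B\Omega^1_B}\sigma_E-(\sigma_E\otimes\mathrm{id})\nabla_{\Omega^1_A\otimes_AE}$.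 Let $B=C^\infty(\mathbb R)$ (complex functions of $s$) with its classical calculus $\Omega^1_B=B\,\mathrm ds$ and connection $\nabla\,\mathrm ds=0$, $\sigma=\mathrm{id}$. Let $E$ be any vector space of smooth complex functions $\phi(s,x)$ on $\mathbb R\times\mathbb R^4$ that is stable under multiplication by $\mathcal F$ and by $B$, under the $D_a$ and under $\partial_s$ (for instance an invariant domain inside $C^\infty(\mathbb R,L^2(\mathbb R^{1,3}))$). It is an $A$-$B$-bimodule, functions acting by multiplication and $p_a$ by $-\imath\hbar D_a$. Put $$\nabla_E\phi=\Big(\frac{\partial\phi}{\partial s}-\frac{\imath\hbar}{2m}\eta^{ab}D_aD_b\phi\Big)\otimes\mathrm ds.$$ **Theorem.** The 1-forms $\mathrm dx^a,\mathrm dp_c,\theta'$ are a basis of $\Omega^1_A$ as a left $A$-module. There is a right bimodule connection $\nabla:\Omega^1_A\to\Omega^1_A\otimes_A\Omega^1_A$ with $\nabla\theta'=0$ and $$\nabla(\mathrm dx^d)=-\tfrac qm\eta^{cd}F_{ac}\,\theta'\otimes\mathrm dx^a+\theta'\otimes\tfrac{\imath\hbar q}{2m^2}\eta^{ab}\eta^{cd}F_{bc,a}\theta',$$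 $$\nabla(\mathrm dp_c)=-qF_{dc,e}\,\mathrm dx^d\otimes\mathrm dx^e-\xi_c\otimes\theta'-\theta'\otimes\eta_c+N_c\,\theta'\otimes\theta',$$ where $$N_c=-\tfrac{\imath\hbar q^2}{2m^2}\eta^{nk}\eta^{ab}(2F_{an}F_{kc,b}+F_{bn,a}F_{kc})+\tfrac{\hbar^2q}{4m^2}\eta^{nk}\eta^{ab}F_{bc,ank},$$ $$\xi_c=-\tfrac{\imath\hbar q}{2m}\eta^{nk}F_{ac,nk}\mathrm dx^a,\qquad \eta_c=-\tfrac{\imath\hbar q}{2m}\eta^{nk}F_{nc,ka}\mathrm dx^a-\tfrac{q^2}m\eta^{eb}F_{ec}F_{ab}\mathrm dx^a.$$ Its braiding $\sigma$ is the flip when one factor is $\theta'$, and $$\sigma(\mathrm dx^e\otimes\mathrm dx^d)=\mathrm dx^d\otimes\mathrm dx^e+\tfrac{\imath\hbar q}{m^2}\eta^{cd}\eta^{ae}F_{ac}\,\theta'\otimes\theta',$$ $$\sigma(\mathrm dp_e\otimes\mathrm dx^d)=\mathrm dx^d\otimes\mathrm dp_e+\tfrac{\imath\hbar q}m\eta^{dc}\theta'\otimes\big(-F_{ae,c}\mathrm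 dx^a-\tfrac qm\eta^{ab}F_{ac}F_{be}\theta'+\tfrac{\imath\hbar}{2m}\eta^{ab}F_{ae,cb}\theta'\big),$$ $$\sigma(\mathrm dx^a\otimes\mathrm dp_c)=\mathrm dp_c\otimes\mathrm dx^a+\tfrac{\imath\hbar q}m\eta^{ea}F_{dc,e}\,\mathrm dx^d\otimes\theta'-\big(\tfrac{\imath\hbar q^2}{m^2}\eta^{bn}\eta^{ra}F_{nc}F_{rb}-\tfrac{\hbar^2q}{2m^2}\eta^{ar}\eta^{nb}F_{bc,nr}\big)\theta'\otimes\theta',$$ $$\begin{aligned}\sigma(\mathrm dp_e\otimes\mathrm dp_d)={}&\mathrm dp_d\otimes\mathrm dp_e+\tfrac{\imath\hbar q^2}m\eta^{rp}\big(F_{rd}F_{ae,p}\,\theta'\otimes\mathrm dx^a-F_{re}F_{ad,p}\,\mathrm dx^a\otimes\theta'\big)\\&+\tfrac{\imath\hbar q^3}{m^2}\eta^{rp}\eta^{ba}F_{pe}F_{ad}F_{rb}\,\theta'\otimes\theta'+\tfrac{\hbar^2q^2}{2m^2}\eta^{rp}\eta^{ab}\big(F_{pd}F_{be,ar}-F_{pd,ar}F_{be}\big)\theta'\otimes\theta'.\end{aligned}$$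 For every $E$ as above, $\nabla_E$ is a right $A$-$B$-bimodule connection, with $\sigma_E(\theta'\otimes\phi)=\phi\otimes\mathrm ds$, $\sigma_E(\mathrm dx^a\otimes\phi)=-\frac{\imath\hbar}m\eta^{ab}D_b\phi\otimes\mathrm ds$ and $\sigma_E(\mathrm dp_c\otimes\phi)=\frac q{2m}\eta^{ab}(2F_{ca}p_b-\imath\hbar F_{cb,a})\phi\otimes\mathrm ds$, and with respect to $\nabla$ one has $\nabla\!\!\!\!\nabla(\sigma_E)=0$. -/

import Mathlib

open scoped TensorProduct ContDiff
open MulOpposite (op)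

noncomputable section

namespace QGeo

/-! ## Bimodules over complex algebras and their tensor products -/

/-- `M` is an `A`-`B`-bimodule (over `ℂ`): commuting unital left `A`- and right `B`-actions
by `ℂ`-linear maps. -/
class Bimodule (A B : outParam Type) (M : Type) [Ring A] [Algebra ℂ A] [Ring B] [Algebra ℂ B]
    [AddCommGroup M] [Module ℂ M] where
  left : A →ₐ[ℂ] Module.End ℂ M
  right : Bᵐᵒᵖ →ₐ[ℂ] Module.End ℂ M
  left_right : ∀ a b m, left a (right b m) = right b (left a m)

section Bimodules

variable {A B C D : Type} [Ring A] [Algebra ℂ A] [Ring B] [Algebra ℂ B] [Ring C] [Algebra ℂ C]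
  [Ring D] [Algebra ℂ D]
variable {M N K : Type} [AddCommGroup M] [Module ℂ M] [AddCommGroup N] [Module ℂ N]
  [AddCommGroup K] [Module ℂ K]

/-- left action `a.m` -/
def lact [Bimodule A B M] (a : A) (m : M) : M := Bimodule.left (B := B) a m

/-- right action `m.b` -/
def ract [Bimodule A B M] (m : M) (b : B) : M := Bimodule.right (A := A) (op b) m

infixr:73 " ▷ " => lact
infixl:73 " ◁ " => ract

section basic
variable [Bimodule A B M]

theorem one_lact (m : M) : (1 : A) ▷ m = m := by simp [lact]
theorem mul_lact (a a' : A) (m : M) : (a * a') ▷ m = a ▷ a' ▷ m := by simp [lact]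
theorem add_lact (a a' : A) (m : M) : (a + a') ▷ m = a ▷ m + a' ▷ m := by simp [lact]
theorem smul_lact (c : ℂ) (a : A) (m : M) : (c • a) ▷ m = c • (a ▷ m) := by simp [lact]
theorem lact_add (a : A) (m m' : M) : a ▷ (m + m') = a ▷ m + a ▷ m' := by simp [lact]
theorem lact_smul (c : ℂ) (a : A) (m : M) : a ▷ (c • m) = c • (a ▷ m) := by simp [lact]
theorem ract_one (m : M) : m ◁ (1 : B) = m := by simp [ract]
theorem ract_mul (m : M) (b b' : B) : m ◁ (b * b') = m ◁ b ◁ b' := by simp [ract]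
theorem ract_add (m : M) (b b' : B) : m ◁ (b + b') = m ◁ b + m ◁ b' := by simp [ract]
theorem ract_smul (c : ℂ) (m : M) (b : B) : m ◁ (c • b) = c • (m ◁ b) := by simp [ract]
theorem add_ract (m m' : M) (b : B) : (m + m') ◁ b = m ◁ b + m' ◁ b := by simp [ract]
theorem smul_ract (c : ℂ) (m : M) (b : B) : (c • m) ◁ b = c • (m ◁ b) := by simp [ract]
theorem lact_ract (a : A) (m : M) (b : B) : a ▷ (m ◁ b) = (a ▷ m) ◁ b :=
  Bimodule.left_right a (op b) m

end basic

/-- The relations `(m.b) ⊗ n = m ⊗ (b.n)`. -/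
def balanced (M N : Type) [AddCommGroup M] [Module ℂ M] [AddCommGroup N] [Module ℂ N]
    [Bimodule A B M] [Bimodule B C N] : Submodule ℂ (M ⊗[ℂ] N) :=
  Submodule.span ℂ {z | ∃ (m : M) (b : B) (n : N), z = (m ◁ b) ⊗ₜ[ℂ] n - m ⊗ₜ[ℂ] (b ▷ n)}

/-- The tensor product `M ⊗_B N` of an `A`-`B`-bimodule and a `B`-`C`-bimodule. -/
def BTensor (M N : Type) [AddCommGroup M] [Module ℂ M] [AddCommGroup N] [Module ℂ N]
    [Bimodule A B M] [Bimodule B C N] : Type :=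
  (M ⊗[ℂ] N) ⧸ balanced M N

section tensor

variable [Bimodule A B M] [Bimodule B C N]

instance : AddCommGroup (BTensor M N) := inferInstanceAs (AddCommGroup ((M ⊗[ℂ] N) ⧸ balanced M N))
instance : Module ℂ (BTensor M N) := inferInstanceAs (Module ℂ ((M ⊗[ℂ] N) ⧸ balanced M N))

/-- the universal balanced bilinear map -/
def tmulₗ (M N : Type) [AddCommGroup M] [Module ℂ M] [AddCommGroup N] [Module ℂ N]
    [Bimodule A B M] [Bimodule B C N] : M →ₗ[ℂ] N →ₗ[ℂ] BTensor M N :=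
  (TensorProduct.mk ℂ M N).compr₂ (balanced M N).mkQ

/-- `m ⊗ n` in `M ⊗_B N` -/
def tmul (m : M) (n : N) : BTensor M N := tmulₗ M N m n

infixl:70 " ⊠ " => tmul

theorem tmul_balanced (m : M) (b : B) (n : N) : (m ◁ b) ⊠ n = m ⊠ (b ▷ n) := by
  refine (Submodule.Quotient.eq _).2 (Submodule.subset_span ⟨m, b, n, rfl⟩)

theorem tmul_add (m : M) (n n' : N) : m ⊠ (n + n') = m ⊠ n + m ⊠ n' := map_add _ _ _
theorem add_tmul (m m' : M) (n : N) : (m + m') ⊠ n = m ⊠ n + m' ⊠ n :=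
  LinearMap.map_add₂ _ _ _ _
theorem tmul_smul (c : ℂ) (m : M) (n : N) : m ⊠ (c • n) = c • (m ⊠ n) := map_smul _ _ _
theorem smul_tmul (c : ℂ) (m : M) (n : N) : (c • m) ⊠ n = c • (m ⊠ n) :=
  LinearMap.map_smul₂ _ _ _ _

/-- a balanced bilinear map factors through `M ⊗_B N` -/
def BTensor.lift (f : M →ₗ[ℂ] N →ₗ[ℂ] K)
    (hf : ∀ (m : M) (b : B) (n : N), f (m ◁ b) n = f m (b ▷ n)) : BTensor M N →ₗ[ℂ] K :=
  (balanced M N).liftQ (TensorProduct.lift f) (by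
    refine Submodule.span_le.2 ?_
    rintro _ ⟨m, b, n, rfl⟩
    simp [hf])

theorem BTensor.lift_tmul (f : M →ₗ[ℂ] N →ₗ[ℂ] K)
    (hf : ∀ (m : M) (b : B) (n : N), f (m ◁ b) n = f m (b ▷ n)) (m : M) (n : N) :
    BTensor.lift f hf (m ⊠ n) = f m n := by
  exact TensorProduct.lift.tmul m n

theorem BTensor.hom_ext {f g : BTensor M N →ₗ[ℂ] K} (h : ∀ m n, f (m ⊠ n) = g (m ⊠ n)) :
    f = g := by
  refine Submodule.linearMap_qext _ (TensorProduct.ext' fun m n => h m n)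

/-- `(a.m) ⊗ n` as an endomorphism -/
def BTensor.leftEnd (a : A) : BTensor M N →ₗ[ℂ] BTensor M N :=
  BTensor.lift ((tmulₗ M N).comp (Bimodule.left (B := B) a : M →ₗ[ℂ] M)) (by
    intro m b n
    change (a ▷ (m ◁ b)) ⊠ n = (a ▷ m) ⊠ (b ▷ n)
    rw [lact_ract, tmul_balanced])

/-- `m ⊗ (n.c)` as an endomorphism -/
def BTensor.rightEnd (c : Cᵐᵒᵖ) : BTensor M N →ₗ[ℂ] BTensor M N :=
  BTensor.lift ((tmulₗ M N).compl₂ (Bimodule.right (A := B) c : N →ₗ[ℂ] N)) (by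
    intro m b n
    change (m ◁ b) ⊠ (n ◁ c.unop) = m ⊠ ((b ▷ n) ◁ c.unop)
    rw [← lact_ract, tmul_balanced])

theorem BTensor.leftEnd_tmul (a : A) (m : M) (n : N) :
    BTensor.leftEnd a (m ⊠ n) = (a ▷ m) ⊠ n := BTensor.lift_tmul _ _ _ _

theorem BTensor.rightEnd_tmul (c : Cᵐᵒᵖ) (m : M) (n : N) :
    BTensor.rightEnd c (m ⊠ n) = m ⊠ (n ◁ c.unop) := BTensor.lift_tmul _ _ _ _

/-- `M ⊗_B N` is an `A`-`C`-bimodule by `a.(m ⊗ n).c = (a.m) ⊗ (n.c)`. -/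
instance : Bimodule A C (BTensor M N) where
  left := AlgHom.ofLinearMap
    { toFun := BTensor.leftEnd
      map_add' := fun a a' => BTensor.hom_ext fun m n => by
        simp only [LinearMap.add_apply, BTensor.leftEnd_tmul, add_lact, add_tmul]
      map_smul' := fun c a => BTensor.hom_ext fun m n => by
        simp only [LinearMap.smul_apply, BTensor.leftEnd_tmul, smul_lact, smul_tmul,
          RingHom.id_apply] }
    (BTensor.hom_ext fun m n => by
      change BTensor.leftEnd 1 (m ⊠ n) = m ⊠ n
      simp only [BTensor.leftEnd_tmul, one_lact])
    (fun a a' => BTensor.hom_ext fun m n => by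
      change BTensor.leftEnd (a * a') (m ⊠ n) = BTensor.leftEnd a (BTensor.leftEnd a' (m ⊠ n))
      simp only [BTensor.leftEnd_tmul, mul_lact])
  right := AlgHom.ofLinearMap
    { toFun := BTensor.rightEnd
      map_add' := fun a a' => BTensor.hom_ext fun m n => by
        simp only [LinearMap.add_apply, BTensor.rightEnd_tmul, MulOpposite.unop_add, ract_add,
          tmul_add]
      map_smul' := fun c a => BTensor.hom_ext fun m n => by
        simp only [LinearMap.smul_apply, BTensor.rightEnd_tmul, MulOpposite.unop_smul, ract_smul,
          tmul_smul, RingHom.id_apply] }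
    (BTensor.hom_ext fun m n => by
      change BTensor.rightEnd 1 (m ⊠ n) = m ⊠ n
      simp only [BTensor.rightEnd_tmul, MulOpposite.unop_one, ract_one])
    (fun a a' => BTensor.hom_ext fun m n => by
      change BTensor.rightEnd (a * a') (m ⊠ n) = BTensor.rightEnd a (BTensor.rightEnd a' (m ⊠ n))
      simp only [BTensor.rightEnd_tmul, MulOpposite.unop_mul, ract_mul])
  left_right := fun a c z => by
    have : (BTensor.leftEnd a).comp (BTensor.rightEnd c)
        = (BTensor.rightEnd c).comp (BTensor.leftEnd (M := M) (N := N) a) :=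
      BTensor.hom_ext fun m n => by
        simp only [LinearMap.comp_apply, BTensor.leftEnd_tmul, BTensor.rightEnd_tmul]
    exact LinearMap.congr_fun this z

theorem lact_tmul (a : A) (m : M) (n : N) : a ▷ (m ⊠ n) = (a ▷ m) ⊠ n :=
  BTensor.leftEnd_tmul a m n

theorem tmul_ract (m : M) (n : N) (c : C) : (m ⊠ n) ◁ c = m ⊠ (n ◁ c) :=
  BTensor.rightEnd_tmul (op c) m n

/-- `f ⊗ id : M ⊗_B N → M' ⊗_B N` for a right `B`-module map `f`. -/
def BTensor.mapLeft {M' : Type} [AddCommGroup M'] [Module ℂ M'] [Bimodule D B M']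
    (f : M →ₗ[ℂ] M') (hf : ∀ (m : M) (b : B), f (m ◁ b) = f m ◁ b) :
    BTensor M N →ₗ[ℂ] BTensor M' N :=
  BTensor.lift ((tmulₗ M' N).comp f) (by
    intro m b n
    change f (m ◁ b) ⊠ n = f m ⊠ (b ▷ n)
    rw [hf, tmul_balanced])

variable [Bimodule C D K]

/-- `n ⊗ k ↦ (m ⊗ n) ⊗ k` -/
def BTensor.reassocAux (K : Type) [AddCommGroup K] [Module ℂ K] [Bimodule C D K] (m : M) :
    BTensor N K →ₗ[ℂ] BTensor (BTensor M N) K :=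
  BTensor.lift ((tmulₗ (BTensor M N) K).comp (tmulₗ M N m)) (by
    intro n c k
    change (m ⊠ (n ◁ c)) ⊠ k = (m ⊠ n) ⊠ (c ▷ k)
    rw [← tmul_ract, tmul_balanced])

theorem BTensor.reassocAux_tmul (m : M) (n : N) (k : K) :
    BTensor.reassocAux K m (n ⊠ k) = (m ⊠ n) ⊠ k := BTensor.lift_tmul _ _ _ _

/-- `n ⊗ k ↦ (m ⊗ n) ⊗ k`, linearly in `m` -/
def BTensor.reassocₗ (M N K : Type) [AddCommGroup M] [Module ℂ M] [AddCommGroup N] [Module ℂ N]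
    [AddCommGroup K] [Module ℂ K] [Bimodule A B M] [Bimodule B C N] [Bimodule C D K] :
    M →ₗ[ℂ] BTensor N K →ₗ[ℂ] BTensor (BTensor M N) K where
  toFun m := BTensor.reassocAux K m
  map_add' m m' := BTensor.hom_ext fun n k => by
    simp only [LinearMap.add_apply, BTensor.reassocAux_tmul, add_tmul]
  map_smul' c m := BTensor.hom_ext fun n k => by
    simp only [RingHom.id_apply, LinearMap.smul_apply, BTensor.reassocAux_tmul, smul_tmul]

/-- The identification `M ⊗_B (N ⊗_C K) → (M ⊗_B N) ⊗_C K`, `m ⊗ (n ⊗ k) ↦ (m ⊗ n) ⊗ k`. -/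
def BTensor.reassoc (M N K : Type) [AddCommGroup M] [Module ℂ M] [AddCommGroup N] [Module ℂ N]
    [AddCommGroup K] [Module ℂ K] [Bimodule A B M] [Bimodule B C N] [Bimodule C D K] :
    BTensor M (BTensor N K) →ₗ[ℂ] BTensor (BTensor M N) K :=
  BTensor.lift (BTensor.reassocₗ M N K) (by
      intro m b z
      have : BTensor.reassocAux K (m ◁ b)
          = (BTensor.reassocAux K m).comp (Bimodule.left (B := D) (M := BTensor N K) b) :=
        BTensor.hom_ext fun n k => by
          change _ = BTensor.reassocAux K m (b ▷ (n ⊠ k))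
          rw [lact_tmul, BTensor.reassocAux_tmul, BTensor.reassocAux_tmul, tmul_balanced]
      exact LinearMap.congr_fun this z)

theorem BTensor.reassoc_tmul (m : M) (n : N) (k : K) :
    BTensor.reassoc M N K (m ⊠ (n ⊠ k)) = (m ⊠ n) ⊠ k := by
  refine (BTensor.lift_tmul (BTensor.reassocₗ M N K) _ m (n ⊠ k)).trans ?_
  exact BTensor.reassocAux_tmul m n k

end tensor

/-! ## Differential calculi, bimodule connections, and the covariant derivative of a map -/

/-- A first order differential calculus `(Ω, d)` on `A`. -/
structure Calculus (A Ω : Type) [Ring A] [Algebra ℂ A] [AddCommGroup Ω] [Module ℂ Ω]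
    [Bimodule A A Ω] where
  d : A →ₗ[ℂ] Ω
  leibniz : ∀ a b : A, d (a * b) = d a ◁ b + a ▷ d b

variable {ΩA ΩB ΩC : Type} [AddCommGroup ΩA] [Module ℂ ΩA] [Bimodule A A ΩA]
  [AddCommGroup ΩB] [Module ℂ ΩB] [Bimodule B B ΩB]
  [AddCommGroup ΩC] [Module ℂ ΩC] [Bimodule C C ΩC]

/-- A right `A`-`B`-bimodule connection `∇ : E → E ⊗_B Ω_B` together with its generalised
braiding, a bimodule map `σ : Ω_A ⊗_A E → E ⊗_B Ω_B`. -/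
structure BimoduleConnection (dA : Calculus A ΩA) (dB : Calculus B ΩB)
    (E : Type) [AddCommGroup E] [Module ℂ E] [Bimodule A B E] where
  nabla : E →ₗ[ℂ] BTensor E ΩB
  sigma : BTensor ΩA E →ₗ[ℂ] BTensor E ΩB
  sigma_left : ∀ (a : A) (z : BTensor ΩA E), sigma (a ▷ z) = a ▷ sigma z
  sigma_right : ∀ (z : BTensor ΩA E) (b : B), sigma (z ◁ b) = sigma z ◁ b
  right_leibniz : ∀ (e : E) (b : B), nabla (e ◁ b) = nabla e ◁ b + e ⊠ dB.d b
  left_leibniz : ∀ (a : A) (e : E), nabla (a ▷ e) = a ▷ nabla e + sigma (dA.d a ⊠ e)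

variable {E F : Type} [AddCommGroup E] [Module ℂ E] [Bimodule A B E]
  [AddCommGroup F] [Module ℂ F] [Bimodule B C F]
variable {dA : Calculus A ΩA} {dB : Calculus B ΩB} {dC : Calculus C ΩC}

/-- `x ⊗ f ↦ (id ⊗ σ_F)(x ⊗ f)` for `x ∈ E ⊗_B Ω_B` and `f ∈ F`. -/
def idSigma (E : Type) [AddCommGroup E] [Module ℂ E] [Bimodule A B E]
    (cF : BimoduleConnection dB dC F) (f : F) :
    BTensor E ΩB →ₗ[ℂ] BTensor (BTensor E F) ΩC :=
  (BTensor.reassoc E F ΩC).comp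
    (BTensor.lift ((tmulₗ E (BTensor F ΩC)).compl₂ (cF.sigma.comp ((tmulₗ ΩB F).flip f))) (by
      intro e b w
      change (e ◁ b) ⊠ cF.sigma (w ⊠ f) = e ⊠ cF.sigma ((b ▷ w) ⊠ f)
      rw [tmul_balanced, ← cF.sigma_left, lact_tmul]))

theorem idSigma_tmul (cF : BimoduleConnection dB dC F) (e : E) (w : ΩB) (f : F) :
    idSigma E cF f (e ⊠ w) = BTensor.reassoc E F ΩC (e ⊠ cF.sigma (w ⊠ f)) := by
  rw [idSigma, LinearMap.comp_apply, BTensor.lift_tmul]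
  rfl

theorem idSigma_ract (cF : BimoduleConnection dB dC F) (x : BTensor E ΩB) (b : B) (f : F) :
    idSigma E cF f (x ◁ b) = idSigma E cF (b ▷ f) x := by
  have : (idSigma E cF f).comp (Bimodule.right (A := A) (op b)) = idSigma E cF (b ▷ f) :=
    BTensor.hom_ext fun e w => by
      change idSigma E cF f ((e ⊠ w) ◁ b) = _
      rw [tmul_ract, idSigma_tmul, idSigma_tmul, tmul_balanced]
  exact LinearMap.congr_fun this x

/-- The tensor product connection `(id ⊗ σ_F)(∇_E ⊗ id) + id ⊗ ∇_F` on `E ⊗_B F`. -/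
def tensorNabla (cE : BimoduleConnection dA dB E) (cF : BimoduleConnection dB dC F) :
    BTensor E F →ₗ[ℂ] BTensor (BTensor E F) ΩC :=
  BTensor.lift
    (LinearMap.mk₂ ℂ
      (fun e f => idSigma E cF f (cE.nabla e) + BTensor.reassoc E F ΩC (e ⊠ cF.nabla f))
      (by
        intro e e' f
        rw [map_add, map_add, add_tmul, map_add]
        abel)
      (by
        intro c e f
        rw [map_smul, map_smul, smul_tmul, map_smul, smul_add])
      (by
        intro e f f'
        have : idSigma E cF (f + f') = idSigma E cF f + idSigma E cF f' :=
          BTensor.hom_ext fun e w => by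
            simp only [LinearMap.add_apply, idSigma_tmul, tmul_add, map_add]
        rw [this, LinearMap.add_apply, map_add, tmul_add, map_add]
        abel)
      (by
        intro c e f
        have : idSigma E cF (c • f) = c • idSigma E cF f :=
          BTensor.hom_ext fun e w => by
            simp only [LinearMap.smul_apply, idSigma_tmul, tmul_smul, map_smul]
        rw [this, LinearMap.smul_apply, map_smul, tmul_smul, map_smul, smul_add]))
    (by
      intro e b f
      simp only [LinearMap.mk₂_apply]
      rw [cE.right_leibniz, cF.left_leibniz, map_add, idSigma_ract, idSigma_tmul, tmul_balanced,
        tmul_add, map_add]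
      abel)

theorem tensorNabla_tmul (cE : BimoduleConnection dA dB E) (cF : BimoduleConnection dB dC F)
    (e : E) (f : F) :
    tensorNabla cE cF (e ⊠ f)
      = idSigma E cF f (cE.nabla e) + BTensor.reassoc E F ΩC (e ⊠ cF.nabla f) := by
  rw [tensorNabla, BTensor.lift_tmul, LinearMap.mk₂_apply]

/-- For linear connections on `Ω_A`, `Ω_B` and a bimodule connection on `E`, the covariant
derivative of the braiding,
`∇∇(σ_E) = ∇_{E ⊗_B Ω_B} σ_E - (σ_E ⊗ id) ∇_{Ω_A ⊗_A E}`. -/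
def doubleNabla (cA : BimoduleConnection dA dA ΩA) (cB : BimoduleConnection dB dB ΩB)
    (cE : BimoduleConnection dA dB E) :
    BTensor ΩA E →ₗ[ℂ] BTensor (BTensor E ΩB) ΩB :=
  (tensorNabla cE cB).comp cE.sigma
    - (BTensor.mapLeft cE.sigma cE.sigma_right).comp (tensorNabla cA cE)

end Bimodules

/-! ## The classical calculus on the geodesic parameter line -/

/-- `B = C^∞(ℝ)` -/
def Line : Subalgebra ℂ (ℝ → ℂ) where
  carrier := {b | ContDiff ℝ ∞ b}
  mul_mem' {b c} hb hc := by
    have hb' : ContDiff ℝ ∞ b := hb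
    have hc' : ContDiff ℝ ∞ c := hc
    exact hb'.mul hc'
  add_mem' {b c} hb hc := by
    have hb' : ContDiff ℝ ∞ b := hb
    have hc' : ContDiff ℝ ∞ c := hc
    exact hb'.add hc'
  algebraMap_mem' c := by
    change ContDiff ℝ ∞ (fun _ : ℝ => c)
    exact contDiff_const

/-- `Ω¹_B = C^∞(ℝ) ds`, the element `b` standing for `b ds` -/
def LineForm : Type := Line

instance : AddCommGroup LineForm := inferInstanceAs (AddCommGroup Line)
instance : Module ℂ LineForm := inferInstanceAs (Module ℂ Line)

/-- the one-form `b ds` -/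
def toForm : Line →ₗ[ℂ] LineForm := LinearMap.id (R := ℂ) (M := Line)

/-- the coefficient `b` of `b ds` -/
def coeff : LineForm →ₗ[ℂ] Line := LinearMap.id (R := ℂ) (M := Line)

/-- the basic one-form `ds` -/
def ds : LineForm := toForm 1

theorem toForm_coeff (w : LineForm) : toForm (coeff w) = w := rfl

/-- multiplication of one-forms by functions -/
def formMul : Line →ₐ[ℂ] Module.End ℂ LineForm := Algebra.lmul ℂ Line

theorem formMul_toForm (b c : Line) : formMul b (toForm c) = toForm (b * c) := rfl

instance : Bimodule Line Line LineForm where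
  left := formMul
  right := formMul.comp (AlgEquiv.toOpposite ℂ Line).symm.toAlgHom
  left_right := fun a b m => by
    change formMul a (formMul b.unop m) = formMul b.unop (formMul a m)
    rw [← Module.End.mul_apply, ← Module.End.mul_apply, ← map_mul, ← map_mul, mul_comm]

/-- the derivative of a smooth function on the line -/
def Line.deriv : Line →ₗ[ℂ] Line where
  toFun b := ⟨_root_.deriv b.1, by
    have hb : ContDiff ℝ ∞ b.1 := b.2
    exact (contDiff_infty_iff_deriv.1 hb).2⟩
  map_add' b c := by
    have hb : ContDiff ℝ ∞ b.1 := b.2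
    have hc : ContDiff ℝ ∞ c.1 := c.2
    ext s
    exact deriv_add (hb.differentiable (by simp) s) (hc.differentiable (by simp) s)
  map_smul' c b := by
    have hb : ContDiff ℝ ∞ b.1 := b.2
    ext s
    exact deriv_const_smul c (hb.differentiable (by simp) s)

theorem Line.deriv_mul (b c : Line) : Line.deriv (b * c) = Line.deriv b * c + b * Line.deriv c := by
  have hb : ContDiff ℝ ∞ b.1 := b.2
  have hc : ContDiff ℝ ∞ c.1 := c.2
  ext s
  exact _root_.deriv_mul (hb.differentiable (by simp) s) (hc.differentiable (by simp) s)

theorem lact_toForm (b c : Line) : b ▷ toForm c = toForm (b * c) := rfl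
theorem toForm_ract (b c : Line) : toForm c ◁ b = toForm (b * c) := rfl

/-- the classical calculus `db = b' ds` -/
def lineCalculus : Calculus Line LineForm where
  d := toForm.comp Line.deriv
  leibniz b c := by
    simp only [LinearMap.comp_apply, Line.deriv_mul, lact_toForm, toForm_ract, map_add]
    rw [mul_comm c]

/-- The trivial linear connection on `Ω¹_B`: `∇ (b ds) = db ⊗ ds`, with `σ = id`. -/
def lineConnection : BimoduleConnection lineCalculus lineCalculus LineForm where
  nabla := ((tmulₗ LineForm LineForm).flip ds).comp (lineCalculus.d.comp coeff)
  sigma := LinearMap.id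
  sigma_left _ _ := rfl
  sigma_right _ _ := rfl
  right_leibniz := by
    intro w b
    let c : Line := coeff w
    change toForm (Line.deriv (b * c)) ⊠ ds
      = (toForm (Line.deriv c) ⊠ ds) ◁ b + toForm c ⊠ toForm (Line.deriv b)
    have h1 : ds ◁ b = b ▷ ds := rfl
    have h2 : toForm (Line.deriv b) = Line.deriv b ▷ ds := by rw [ds, lact_toForm, mul_one]
    rw [tmul_ract, h1, h2, ← tmul_balanced, ← tmul_balanced, ← add_tmul, toForm_ract, toForm_ract,
      ← map_add, Line.deriv_mul, add_comm]
  left_leibniz := by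
    intro b w
    let c : Line := coeff w
    change toForm (Line.deriv (b * c)) ⊠ ds
      = b ▷ (toForm (Line.deriv c) ⊠ ds) + toForm (Line.deriv b) ⊠ toForm c
    have h2 : toForm c = c ▷ ds := by rw [ds, lact_toForm, mul_one]
    rw [lact_tmul, h2, ← tmul_balanced, ← add_tmul, toForm_ract, lact_toForm, ← map_add,
      Line.deriv_mul, add_comm, mul_comm c]

/-! ## The electromagnetic Heisenberg algebra -/

/-- points `(x⁰, x¹, x², x³)` of spacetime -/
abbrev Spacetime : Type := Fin 4 → ℝ

/-- `η = diag(-1, 1, 1, 1)` -/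
def eta (a b : Fin 4) : ℂ := if a = b then (if a = 0 then -1 else 1) else 0

/-- `∂f/∂x^a` -/
def pdFun (a : Fin 4) (f : Spacetime → ℂ) : Spacetime → ℂ :=
  fun x => fderiv ℝ f x (Pi.single a 1)

/-- `F_{ab} = A_{b,a} - A_{a,b}` -/
def faraday (pot : Fin 4 → Spacetime → ℝ) (a b : Fin 4) : Spacetime → ℂ :=
  fun x => pdFun a (fun y => (pot b y : ℂ)) x - pdFun b (fun y => (pot a y : ℂ)) x

/-- Physical constants, a smooth real gauge potential, and the algebra `fn` of those functions of
the `x^a` that are admitted in the Heisenberg algebra: any algebra of smooth functions which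
contains the coordinates and the field strength and is closed under partial derivatives. Both
the full algebra `C^∞(ℝ⁴)` and the algebra generated by the `x^a` and all derivatives of
the `F_{ab}` are possible. -/
structure Background where
  hbar : ℝ
  q : ℝ
  m : ℝ
  hbar_ne : hbar ≠ 0
  m_ne : m ≠ 0
  pot : Fin 4 → Spacetime → ℝ
  pot_smooth : ∀ a, ContDiff ℝ ∞ (pot a)
  fn : Subalgebra ℂ (Spacetime → ℂ)
  fn_smooth : ∀ f ∈ fn, ContDiff ℝ ∞ f
  fn_coord : ∀ a : Fin 4, (fun x : Spacetime => (x a : ℂ)) ∈ fn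
  fn_pd : ∀ f ∈ fn, ∀ a, pdFun a f ∈ fn
  fn_faraday : ∀ a b, faraday pot a b ∈ fn

variable (P : Background)

namespace Background

/-- `ħ`, `q`, `m` as complex numbers -/
def ħ : ℂ := P.hbar
def qc : ℂ := P.q
def mc : ℂ := P.m

/-- the type of admitted functions of the `x^a` -/
abbrev Fn : Type := P.fn

/-- the coordinate function `x^a` -/
def coord (a : Fin 4) : P.Fn := ⟨_, P.fn_coord a⟩

/-- `f_{,a}` -/
def pd (a : Fin 4) (f : P.Fn) : P.Fn := ⟨pdFun a f.1, P.fn_pd f.1 f.2 a⟩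

/-- `F_{ab}` -/
def F (a b : Fin 4) : P.Fn := ⟨faraday P.pot a b, P.fn_faraday a b⟩

/-- `F_{ab,c}` -/
def F1 (a b c : Fin 4) : P.Fn := P.pd c (P.F a b)

/-- `F_{ab,cd}` -/
def F2 (a b c d : Fin 4) : P.Fn := P.pd d (P.F1 a b c)

/-- `F_{ab,cde}` -/
def F3 (a b c d e : Fin 4) : P.Fn := P.pd e (P.F2 a b c d)

end Background

open Complex (I)
open Background

/-- The relations of the electromagnetic Heisenberg algebra on generators `f` (functions of the
`x^a`) and `p_a`: the functions multiply and add as functions, `[f, p_a] = iħ f_{,a}` (in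
particular `[x^a, p_b] = iħ δ^a_b`) and `[p_a, p_b] = iħ q F_{ab}`. -/
inductive HeisRel : FreeAlgebra ℂ (P.Fn ⊕ Fin 4) → FreeAlgebra ℂ (P.Fn ⊕ Fin 4) → Prop
  | fn_add (f g : P.Fn) : HeisRel (FreeAlgebra.ι ℂ (Sum.inl (f + g)))
      (FreeAlgebra.ι ℂ (Sum.inl f) + FreeAlgebra.ι ℂ (Sum.inl g))
  | fn_mul (f g : P.Fn) : HeisRel (FreeAlgebra.ι ℂ (Sum.inl (f * g)))
      (FreeAlgebra.ι ℂ (Sum.inl f) * FreeAlgebra.ι ℂ (Sum.inl g))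
  | fn_const (c : ℂ) : HeisRel (FreeAlgebra.ι ℂ (Sum.inl (algebraMap ℂ P.Fn c)))
      (algebraMap ℂ _ c)
  | fn_p (f : P.Fn) (a : Fin 4) : HeisRel
      (FreeAlgebra.ι ℂ (Sum.inl f) * FreeAlgebra.ι ℂ (Sum.inr a)
        - FreeAlgebra.ι ℂ (Sum.inr a) * FreeAlgebra.ι ℂ (Sum.inl f))
      ((I * P.ħ) • FreeAlgebra.ι ℂ (Sum.inl (P.pd a f)))
  | p_p (a b : Fin 4) : HeisRel
      (FreeAlgebra.ι ℂ (Sum.inr a) * FreeAlgebra.ι ℂ (Sum.inr b)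
        - FreeAlgebra.ι ℂ (Sum.inr b) * FreeAlgebra.ι ℂ (Sum.inr a))
      ((I * P.ħ * P.qc) • FreeAlgebra.ι ℂ (Sum.inl (P.F a b)))

/-- The electromagnetic Heisenberg algebra. -/
def Heis : Type := RingQuot (HeisRel P)

instance : Ring (Heis P) := inferInstanceAs (Ring (RingQuot (HeisRel P)))
instance : Algebra ℂ (Heis P) := inferInstanceAs (Algebra ℂ (RingQuot (HeisRel P)))

variable {P}

/-- a function of the `x^a` as an element of the Heisenberg algebra -/
def fnH (f : P.Fn) : Heis P :=
  RingQuot.mkAlgHom ℂ (HeisRel P) (FreeAlgebra.ι ℂ (Sum.inl f))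

variable (P)

/-- the generator `x^a` -/
def xH (a : Fin 4) : Heis P := fnH (P.coord a)

/-- the generator `p_a` -/
def pH (a : Fin 4) : Heis P :=
  RingQuot.mkAlgHom ℂ (HeisRel P) (FreeAlgebra.ι ℂ (Sum.inr a))

/-! ## The centrally extended calculus -/

/-- symbols for the generators of `Ω¹` as a bimodule: `da` for each `a`, and `θ'` -/
inductive FormGen : Type
  | d (a : Heis P) : FormGen
  | theta : FormGen

/-- the enveloping algebra `A ⊗ A^op`, whose left modules are the `A`-bimodules -/
def Env : Type := Heis P ⊗[ℂ] (Heis P)ᵐᵒᵖ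

instance : Ring (Env P) := inferInstanceAs (Ring (Heis P ⊗[ℂ] (Heis P)ᵐᵒᵖ))
instance : Algebra ℂ (Env P) := inferInstanceAs (Algebra ℂ (Heis P ⊗[ℂ] (Heis P)ᵐᵒᵖ))

/-- `a ↦ a ⊗ 1` -/
def envL : Heis P →ₐ[ℂ] Env P :=
  (Algebra.TensorProduct.includeLeft : Heis P →ₐ[ℂ] Heis P ⊗[ℂ] (Heis P)ᵐᵒᵖ)

/-- `b ↦ 1 ⊗ b` -/
def envR : (Heis P)ᵐᵒᵖ →ₐ[ℂ] Env P :=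
  (Algebra.TensorProduct.includeRight : (Heis P)ᵐᵒᵖ →ₐ[ℂ] Heis P ⊗[ℂ] (Heis P)ᵐᵒᵖ)

theorem envL_mul_envR (a : Heis P) (b : (Heis P)ᵐᵒᵖ) :
    envL P a * envR P b = envR P b * envL P a := by
  change (a ⊗ₜ[ℂ] (1 : (Heis P)ᵐᵒᵖ)) * ((1 : Heis P) ⊗ₜ[ℂ] b)
    = ((1 : Heis P) ⊗ₜ[ℂ] b) * (a ⊗ₜ[ℂ] (1 : (Heis P)ᵐᵒᵖ))
  rw [Algebra.TensorProduct.tmul_mul_tmul, Algebra.TensorProduct.tmul_mul_tmul]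
  simp

/-- The free `A`-bimodule on these symbols, i.e. the free `A ⊗ A^op`-module. -/
abbrev FreeForm : Type := FormGen P →₀ Env P

variable {P}

/-- the symbol `da` -/
def symD (a : Heis P) : FreeForm P := Finsupp.single (FormGen.d a) 1

variable (P)

/-- the symbol `θ'` -/
def symTheta : FreeForm P := Finsupp.single FormGen.theta 1

variable {P}

/-- `a.ξ` in the free bimodule -/
def freeL (a : Heis P) (ξ : FreeForm P) : FreeForm P := envL P a • ξ

/-- `ξ.a` in the free bimodule -/
def freeR (ξ : FreeForm P) (a : Heis P) : FreeForm P := envR P (op a) • ξ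

/-- `[ξ, a] = ξ.a - a.ξ` in the free bimodule -/
def freeComm (ξ : FreeForm P) (a : Heis P) : FreeForm P := freeR ξ a - freeL a ξ

variable (P)

/-- The relations (elements set to zero) of the calculus: linearity and the Leibniz rule for `d`,
centrality of `θ'`, and the commutation relations of the calculus. -/
inductive FormRel : FreeForm P → Prop
  | d_add (a b : Heis P) : FormRel (symD (a + b) - (symD a + symD b))
  | d_smul (c : ℂ) (a : Heis P) : FormRel (symD (c • a) - c • symD a)
  | leibniz (a b : Heis P) : FormRel (symD (a * b) - (freeR (symD a) b + freeL a (symD b)))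
  | theta_central (a : Heis P) : FormRel (freeComm (symTheta P) a)
  /-- `df = f_{,a} dx^a - (iħ/2m) η^{ab} f_{,ab} θ'` -/
  | d_fn (f : P.Fn) : FormRel (symD (fnH f)
      - (∑ a, freeL (fnH (P.pd a f)) (symD (xH P a))
        - (I * P.ħ / (2 * P.mc)) •
            ∑ a, ∑ b, eta a b • freeL (fnH (P.pd b (P.pd a f))) (symTheta P)))
  /-- `[dx^a, f] = -(iħ/m) η^{ab} f_{,b} θ'`, so `[dx^a, x^b] = -(iħ/m) η^{ab} θ'` -/
  | dx_fn (a : Fin 4) (f : P.Fn) : FormRel (freeComm (symD (xH P a)) (fnH f)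
      - (-(I * P.ħ / P.mc)) • ∑ b, eta a b • freeL (fnH (P.pd b f)) (symTheta P))
  /-- `[dx^a, p_c] = (iħq/m) η^{ab} F_{bc} θ'` -/
  | dx_p (a c : Fin 4) : FormRel (freeComm (symD (xH P a)) (pH P c)
      - (I * P.ħ * P.qc / P.mc) • ∑ b, eta a b • freeL (fnH (P.F b c)) (symTheta P))
  /-- `[dp_c, f] = (iħq/m) η^{ab} F_{bc} f_{,a} θ'`, so
  `[dp_c, x^a] = (iħq/m) η^{ab} F_{bc} θ'` -/
  | dp_fn (c : Fin 4) (f : P.Fn) : FormRel (freeComm (symD (pH P c)) (fnH f)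
      - (I * P.ħ * P.qc / P.mc) •
          ∑ a, ∑ b, eta a b • freeL (fnH (P.F b c * P.pd a f)) (symTheta P))
  /-- `[dp_c, p_d] = -iħq F_{ac,d} dx^a
    - (ħq/2m) η^{ab} (ħ F_{bc,ad} + 2iq F_{ac} F_{bd}) θ'` -/
  | dp_p (c d : Fin 4) : FormRel (freeComm (symD (pH P c)) (pH P d)
      - ((-(I * P.ħ * P.qc)) • ∑ a, freeL (fnH (P.F1 a c d)) (symD (xH P a))
        - (P.ħ * P.qc / (2 * P.mc)) • ∑ a, ∑ b, eta a b •
            freeL (fnH (P.ħ • P.F2 b c a d + (2 * I * P.qc) • (P.F a c * P.F b d)))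
              (symTheta P)))

/-- the sub-bimodule generated by the relations -/
def formRelations : Submodule (Env P) (FreeForm P) :=
  Submodule.span _ {ξ | FormRel P ξ}

/-- The bimodule `Ω¹` of one-forms on the electromagnetic Heisenberg algebra. -/
def Form : Type := FreeForm P ⧸ formRelations P

instance : AddCommGroup (Form P) := inferInstanceAs (AddCommGroup (FreeForm P ⧸ formRelations P))
instance : Module (Env P) (Form P) :=
  inferInstanceAs (Module _ (FreeForm P ⧸ formRelations P))
instance : Module ℂ (Form P) := inferInstanceAs (Module ℂ (FreeForm P ⧸ formRelations P))
instance : IsScalarTower ℂ (Env P) (Form P) :=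
  inferInstanceAs (IsScalarTower ℂ _ (FreeForm P ⧸ formRelations P))

instance : Bimodule (Heis P) (Heis P) (Form P) where
  left := (Algebra.lsmul ℂ ℂ (Form P)).comp (envL P)
  right := (Algebra.lsmul ℂ ℂ (Form P)).comp (envR P)
  left_right a b ξ := by
    change envL P a • envR P b • ξ = envR P b • envL P a • ξ
    rw [smul_smul, smul_smul, envL_mul_envR]

/-- the class of an element of the free bimodule -/
def toΩ (ξ : FreeForm P) : Form P := (formRelations P).mkQ ξ

theorem toΩ_eq {ξ ζ : FreeForm P} (h : FormRel P (ξ - ζ)) : toΩ P ξ = toΩ P ζ :=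
  (Submodule.Quotient.eq _).2 (Submodule.subset_span h)

/-- the differential calculus `d : A → Ω¹` -/
def heisCalculus : Calculus (Heis P) (Form P) where
  d :=
    { toFun := fun a => toΩ P (symD a)
      map_add' := fun a b => toΩ_eq P (FormRel.d_add a b)
      map_smul' := fun c a => toΩ_eq P (FormRel.d_smul c a) }
  leibniz a b := toΩ_eq P (FormRel.leibniz a b)

/-- the central one-form `θ'` -/
def θ : Form P := toΩ P (symTheta P)

/-- `dx^a` -/
def dx (a : Fin 4) : Form P := (heisCalculus P).d (xH P a)

/-- `dp_a` -/
def dp (a : Fin 4) : Form P := (heisCalculus P).d (pH P a)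

/-! ## The Schrödinger representation and the Klein–Gordon connection -/

/-- `D_a φ = ∂φ/∂x^a - i (q/ħ) A_a φ` for a function `φ(s, x)` -/
def covD (a : Fin 4) (φ : ℝ × Spacetime → ℂ) : ℝ × Spacetime → ℂ :=
  fun z => fderiv ℝ φ z (0, Pi.single a 1) - I * (P.qc / P.ħ) * (P.pot a z.2 : ℂ) * φ z

/-- `∂φ/∂s` -/
def timeD (φ : ℝ × Spacetime → ℂ) : ℝ × Spacetime → ℂ :=
  fun z => fderiv ℝ φ z (1, 0)

/-- A common invariant domain for the operators of the theory: a space `E` of `s`-dependent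
complex wave functions `φ(s, x)`, smooth, on which the admitted functions of `x`, the `D_a`,
the functions of `s` and `∂/∂s` all act. -/
structure StateSpace where
  space : Submodule ℂ (ℝ × Spacetime → ℂ)
  smooth : ∀ φ ∈ space, ContDiff ℝ ∞ φ
  fn_mul : ∀ f ∈ P.fn, ∀ φ ∈ space, (fun z => f z.2 * φ z) ∈ space
  covD_mem : ∀ a, ∀ φ ∈ space, covD P a φ ∈ space
  time_mul : ∀ b ∈ Line, ∀ φ ∈ space, (fun z => b z.1 * φ z) ∈ space
  timeD_mem : ∀ φ ∈ space, timeD φ ∈ space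

namespace StateSpace

variable {P} (E : StateSpace P)

theorem diff (φ : E.space) : Differentiable ℝ φ.1 :=
  (E.smooth φ.1 φ.2).differentiable (by simp)

/-- multiplication by a function of `x` -/
def mulFn (f : P.Fn) : Module.End ℂ E.space where
  toFun φ := ⟨fun z => f.1 z.2 * φ.1 z, E.fn_mul f.1 f.2 φ.1 φ.2⟩
  map_add' φ ψ := by ext z; exact mul_add _ _ _
  map_smul' c φ := by ext z; exact mul_left_comm _ _ _

/-- multiplication by a function of `s` -/
def mulLine (b : Line) : Module.End ℂ E.space where
  toFun φ := ⟨fun z => b.1 z.1 * φ.1 z, E.time_mul b.1 b.2 φ.1 φ.2⟩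
  map_add' φ ψ := by ext z; exact mul_add _ _ _
  map_smul' c φ := by ext z; exact mul_left_comm _ _ _

/-- `D_a` as an operator -/
def D (a : Fin 4) : Module.End ℂ E.space where
  toFun φ := ⟨covD P a φ.1, E.covD_mem a φ.1 φ.2⟩
  map_add' φ ψ := by
    ext z
    change covD P a (φ.1 + ψ.1) z = covD P a φ.1 z + covD P a ψ.1 z
    simp only [covD, fderiv_add (E.diff φ z) (E.diff ψ z), add_apply,
      Pi.add_apply]
    ring
  map_smul' c φ := by
    ext z
    change covD P a (c • φ.1) z = c * covD P a φ.1 z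
    simp only [covD, fderiv_const_smul (E.diff φ z), smul_apply,
      Pi.smul_apply, smul_eq_mul]
    ring

/-- `∂/∂s` as an operator -/
def dds : Module.End ℂ E.space where
  toFun φ := ⟨timeD φ.1, E.timeD_mem φ.1 φ.2⟩
  map_add' φ ψ := by
    ext z
    change timeD (φ.1 + ψ.1) z = timeD φ.1 z + timeD ψ.1 z
    simp only [timeD, fderiv_add (E.diff φ z) (E.diff ψ z), add_apply]
  map_smul' c φ := by
    ext z
    change timeD (c • φ.1) z = c * timeD φ.1 z
    simp only [timeD, fderiv_const_smul (E.diff φ z), smul_apply,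
      smul_eq_mul]

theorem fderiv_snd_dir (g : Spacetime → ℂ) (hg : Differentiable ℝ g) (z : ℝ × Spacetime)
    (a : Fin 4) :
    fderiv ℝ (fun z : ℝ × Spacetime => g z.2) z (0, Pi.single a 1) = pdFun a g z.2 := by
  have h : HasFDerivAt (fun z : ℝ × Spacetime => g z.2)
      ((fderiv ℝ g z.2).comp (ContinuousLinearMap.snd ℝ ℝ Spacetime)) z :=
    (hg z.2).hasFDerivAt.comp z hasFDerivAt_snd
  rw [h.fderiv]
  rfl

theorem covD_mul (a : Fin 4) (g : Spacetime → ℂ) (hg : Differentiable ℝ g)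
    (φ : ℝ × Spacetime → ℂ) (hφ : Differentiable ℝ φ) (z : ℝ × Spacetime) :
    covD P a (fun z => g z.2 * φ z) z = g z.2 * covD P a φ z + pdFun a g z.2 * φ z := by
  have hg' : Differentiable ℝ (fun z : ℝ × Spacetime => g z.2) := hg.comp differentiable_snd
  have := fderiv_fun_mul (hg' z) (hφ z)
  simp only [covD, this, add_apply, smul_apply,
    smul_eq_mul, fderiv_snd_dir g hg]
  ring

theorem D_comm (a b : Fin 4) (φ : E.space) :
    E.D a (E.D b φ) - E.D b (E.D a φ) = (-(I * (P.qc / P.ħ))) • E.mulFn (P.F a b) φ := by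
  ext z
  have hφ := E.smooth φ.1 φ.2
  have hA : ∀ c, ContDiff ℝ ∞ (fun y => (P.pot c y : ℂ)) := fun c =>
    Complex.ofRealCLM.contDiff.comp (P.pot_smooth c)
  have hAd : ∀ c, Differentiable ℝ (fun y => (P.pot c y : ℂ)) := fun c =>
    (hA c).differentiable (by simp)
  have hAs : ∀ c, Differentiable ℝ (fun z : ℝ × Spacetime => (P.pot c z.2 : ℂ)) := fun c =>
    (hAd c).comp differentiable_snd
  have h2 : ∀ v w : ℝ × Spacetime, fderiv ℝ (fun y => fderiv ℝ φ.1 y v) z w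
      = fderiv ℝ (fderiv ℝ φ.1) z w v := by
    intro v w
    have hd : DifferentiableAt ℝ (fderiv ℝ φ.1) z :=
      ((hφ.fderiv_right (m := ∞) (by simp)).differentiable (by simp)) z
    rw [fderiv_clm_apply hd (differentiableAt_const v)]
    simp
  have hsym : ∀ v w : ℝ × Spacetime, fderiv ℝ (fderiv ℝ φ.1) z w v
      = fderiv ℝ (fderiv ℝ φ.1) z v w := fun v w =>
    (hφ.contDiffAt.isSymmSndFDerivAt (by
      rw [minSmoothness_of_isRCLikeNormedField]; exact ENat.LEInfty.out)) w v
  have hcov : ∀ c d : Fin 4, covD P c (covD P d φ.1) z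
      = fderiv ℝ (fderiv ℝ φ.1) z (0, Pi.single c 1) (0, Pi.single d 1)
        - I * (P.qc / P.ħ) * (pdFun c (fun y => (P.pot d y : ℂ)) z.2 * φ.1 z
            + (P.pot d z.2 : ℂ) * fderiv ℝ φ.1 z (0, Pi.single c 1))
        - I * (P.qc / P.ħ) * (P.pot c z.2 : ℂ) * covD P d φ.1 z := by
    intro c d
    have hd1 : DifferentiableAt ℝ (fun y => fderiv ℝ φ.1 y (0, Pi.single d 1)) z :=
      (((hφ.fderiv_right (m := ∞) (by simp)).clm_apply contDiff_const).differentiable (by simp)) z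
    have hd2 : DifferentiableAt ℝ (fun z : ℝ × Spacetime => (P.pot d z.2 : ℂ) * φ.1 z) z :=
      ((hAs d) z).mul (E.diff φ z)
    have he : covD P d φ.1 = fun y => fderiv ℝ φ.1 y (0, Pi.single d 1)
        - (I * (P.qc / P.ħ)) * ((P.pot d y.2 : ℂ) * φ.1 y) := by
      funext y
      simp only [covD]
      ring
    rw [covD, he, fderiv_fun_sub hd1 (hd2.const_mul _), fderiv_const_mul hd2,
      fderiv_fun_mul ((hAs d) z) (E.diff φ z)]
    simp only [sub_apply, add_apply,
      smul_apply, smul_eq_mul, h2, fderiv_snd_dir _ (hAd d)]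
    ring
  change covD P a (covD P b φ.1) z - covD P b (covD P a φ.1) z
    = (-(I * (P.qc / P.ħ))) * (faraday P.pot a b z.2 * φ.1 z)
  rw [hcov, hcov, hsym]
  simp only [covD, faraday]
  ring

theorem ħ_ne : P.ħ ≠ 0 := by
  simp [Background.ħ, P.hbar_ne]

/-- The Schrödinger representation: functions of `x` act by multiplication and
`p_a` acts by `-iħ D_a`. -/
def rep : Heis P →ₐ[ℂ] Module.End ℂ E.space :=
  RingQuot.liftAlgHom ℂ ⟨FreeAlgebra.lift ℂ
    (Sum.elim E.mulFn (fun a => (-(I * P.ħ)) • E.D a)), by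
    intro u v h
    have hI : I * I = -1 := Complex.I_mul_I
    induction h with
    | fn_add f g =>
      simp only [FreeAlgebra.lift_ι_apply, map_add, Sum.elim_inl]
      ext φ z
      exact add_mul _ _ _
    | fn_mul f g =>
      simp only [FreeAlgebra.lift_ι_apply, map_mul, Sum.elim_inl]
      ext φ z
      exact mul_assoc _ _ _
    | fn_const c =>
      simp only [FreeAlgebra.lift_ι_apply, Sum.elim_inl, AlgHom.commutes]
      ext φ z
      rfl
    | fn_p f a =>
      simp only [FreeAlgebra.lift_ι_apply, map_sub, map_mul, map_smul, Sum.elim_inl, Sum.elim_inr]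
      ext φ z
      change f.1 z.2 * ((-(I * P.ħ)) * covD P a φ.1 z)
          - (-(I * P.ħ)) * covD P a (fun z => f.1 z.2 * φ.1 z) z
        = (I * P.ħ) * (pdFun a f.1 z.2 * φ.1 z)
      rw [covD_mul a f.1 ((P.fn_smooth f.1 f.2).differentiable (by simp)) φ.1 (E.diff φ)]
      ring
    | p_p a b =>
      simp only [FreeAlgebra.lift_ι_apply, map_sub, map_mul, map_smul, Sum.elim_inl, Sum.elim_inr]
      apply LinearMap.ext
      intro φ
      have key : ∀ c : ℂ, ((c • E.D a) * (c • E.D b) - (c • E.D b) * (c • E.D a)) φ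
            = (c * c) • (E.D a (E.D b φ) - E.D b (E.D a φ)) := by
        intro c
        simp only [LinearMap.sub_apply, Module.End.mul_apply, LinearMap.smul_apply, map_smul,
          smul_smul, smul_sub]
      have hc : (-(I * P.ħ)) * (-(I * P.ħ)) * (-(I * (P.qc / P.ħ))) = I * P.ħ * P.qc := by
        have h0 := ħ_ne (P := P)
        field_simp
        linear_combination (-P.qc) * hI
      rw [key, D_comm, smul_smul, LinearMap.smul_apply, hc]⟩

theorem rep_mk (u : FreeAlgebra ℂ (P.Fn ⊕ Fin 4)) :
    E.rep (RingQuot.mkAlgHom ℂ (HeisRel P) u) = FreeAlgebra.lift ℂ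
      (Sum.elim E.mulFn (fun a => (-(I * P.ħ)) • E.D a)) u :=
  RingQuot.liftAlgHom_mkAlgHom_apply _ _ _ _

theorem D_mulLine (a : Fin 4) (b : Line) : E.D a * E.mulLine b = E.mulLine b * E.D a := by
  ext φ z
  have hb : Differentiable ℝ b.1 := by
    have h : ContDiff ℝ ∞ b.1 := b.2
    exact h.differentiable (by simp)
  have h : HasFDerivAt (fun z : ℝ × Spacetime => b.1 z.1)
      ((fderiv ℝ b.1 z.1).comp (ContinuousLinearMap.fst ℝ ℝ Spacetime)) z :=
    (hb z.1).hasFDerivAt.comp z hasFDerivAt_fst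
  change covD P a (fun z => b.1 z.1 * φ.1 z) z = b.1 z.1 * covD P a φ.1 z
  have h' : fderiv ℝ (fun z : ℝ × Spacetime => b.1 z.1 * φ.1 z) z = _ :=
    (h.mul (E.diff φ z).hasFDerivAt).fderiv
  simp only [covD, h', add_apply, smul_apply, smul_eq_mul,
    ContinuousLinearMap.comp_apply, ContinuousLinearMap.coe_fst', map_zero]
  ring

theorem rep_mulLine (a : Heis P) (b : Line) :
    E.rep a * E.mulLine b = E.mulLine b * E.rep a := by
  obtain ⟨u, rfl⟩ := RingQuot.mkAlgHom_surjective ℂ (HeisRel P) a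
  rw [rep_mk]
  induction u using FreeAlgebra.induction with
  | grade0 r => rw [AlgHom.commutes]; exact Algebra.commutes _ _
  | grade1 x =>
    rw [FreeAlgebra.lift_ι_apply]
    rcases x with f | c
    · ext φ z
      exact mul_left_comm _ _ _
    · simp only [Sum.elim_inr, smul_mul_assoc, mul_smul_comm, D_mulLine]
  | mul u v hu hv => rw [map_mul, mul_assoc, hv, ← mul_assoc, hu, mul_assoc]
  | add u v hu hv => rw [map_add, add_mul, mul_add, hu, hv]

/-- `E` is an `A`-`B`-bimodule, by the Schrödinger representation and pointwise multiplication
by functions of `s`. -/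
instance : Bimodule (Heis P) Line E.space where
  left := E.rep
  right := (AlgHom.ofLinearMap
    { toFun := E.mulLine
      map_add' := fun b c => by ext φ z; exact add_mul _ _ _
      map_smul' := fun r b => by ext φ z; exact mul_assoc _ _ _ }
    (by ext φ z; exact one_mul _)
    (fun b c => by ext φ z; exact mul_assoc _ _ _)).comp
      (AlgEquiv.toOpposite ℂ Line).symm.toAlgHom
  left_right a b φ := LinearMap.congr_fun (E.rep_mulLine a b.unop) φ

/-- The operator `∂_s - (iħ/2m) η^{ab} D_a D_b`. -/
def kleinGordon : Module.End ℂ E.space :=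
  E.dds - (I * P.ħ / (2 * P.mc)) • ∑ a, ∑ b, eta a b • (E.D a * E.D b)

/-- `∇_E φ = (∂_s φ - (iħ/2m) η^{ab} D_a D_b φ) ⊗ ds` -/
def nablaE : E.space →ₗ[ℂ] BTensor E.space LineForm :=
  ((tmulₗ E.space LineForm).flip ds).comp E.kleinGordon

end StateSpace

/-! ## Coefficients of the connection -/

/-- `X(dp_c) = (q/2m) η^{ab} (2 F_{ca} p_b - iħ F_{cb,a})` -/
def Xdp (c : Fin 4) : Heis P :=
  (P.qc / (2 * P.mc)) • ∑ a, ∑ b, eta a b •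
    ((2 : ℂ) • (fnH (P.F c a) * pH P b) - (I * P.ħ) • fnH (P.F1 c b a))

/-- `N_c = -(iħq²/2m²) η^{nk} η^{ab} (2 F_{an} F_{kc,b} + F_{bn,a} F_{kc})
  + (ħ²q/4m²) η^{nk} η^{ab} F_{bc,ank}` -/
def Ncoef (c : Fin 4) : P.Fn :=
  (-(I * P.ħ * P.qc ^ 2 / (2 * P.mc ^ 2))) • (∑ n, ∑ k, ∑ a, ∑ b, (eta n k * eta a b) •
      ((2 : ℂ) • (P.F a n * P.F1 k c b) + P.F1 b n a * P.F k c))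
    + (P.ħ ^ 2 * P.qc / (4 * P.mc ^ 2)) •
      ∑ n, ∑ k, ∑ a, ∑ b, (eta n k * eta a b) • P.F3 b c a n k

/-- `ξ_c = -(iħq/2m) η^{nk} F_{ac,nk} dx^a` -/
def xiForm (c : Fin 4) : Form P :=
  (-(I * P.ħ * P.qc / (2 * P.mc))) •
    ∑ n, ∑ k, ∑ a, eta n k • (fnH (P.F2 a c n k) ▷ dx P a)

/-- `η_c = -(iħq/2m) η^{nk} F_{nc,ka} dx^a - (q²/m) η^{eb} F_{ec} F_{ab} dx^a` -/
def etaForm (c : Fin 4) : Form P :=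
  (-(I * P.ħ * P.qc / (2 * P.mc))) •
      (∑ n, ∑ k, ∑ a, eta n k • (fnH (P.F2 n c k a) ▷ dx P a))
    - (P.qc ^ 2 / P.mc) •
      ∑ e, ∑ b, ∑ a, eta e b • (fnH (P.F e c * P.F a b) ▷ dx P a)

end QGeo

end

open QGeo
open Complex (I)

/-!
The one-forms `y^a = dx^a - η^{ab} p_b θ' / m`,
`z_c = dp_c + q F_{ac} dx^a - (iħq / 2m) η^{ab} F_{ac,b} θ'` and `θ'` commute with the algebra.
They are a basis, because their dual coordinates exist as bimodule maps `Ω¹ → A`: up to a factor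
`i/ħ` these are the inner derivations `da ↦ [p_b, a]`, `[x^b, a]`, `[h, a]` for the Hamiltonian
`h = η^{ab} p_a p_b / 2m`, the last one, `X`, sending `θ'` to `1`. A central basis carries a
canonical flip, and any choice of central covariant derivatives for its members extends to a
bimodule connection with that flip as braiding; `∇y^d = -η^{dc} θ' ⊗ z_c / m`, `∇z_c = ∇θ' = 0`
gives the connection of the theorem once `dx^a` and `dp_c` are expanded in the basis.

The Klein–Gordon operator is `K = ∂_s + (i/ħ) h`, so `[K, a]` acts as `X(da)` and
`σ_E(ξ ⊗ φ) = X(ξ) φ ⊗ ds`. Then `∇∇(σ_E) = 0` comes down to `(X ⊗ X)(∇ξ) = X(d(X(ξ)))`.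
-/

open scoped TensorProduct ContDiff
open MulOpposite (op)

noncomputable section

namespace QGeo

open Background

section Bimodules

variable {A B C : Type} [Ring A] [Algebra ℂ A] [Ring B] [Algebra ℂ B] [Ring C] [Algebra ℂ C]
variable {M N : Type} [AddCommGroup M] [Module ℂ M] [AddCommGroup N] [Module ℂ N]
variable [Bimodule A B M] [Bimodule B C N] {ι : Type*}

theorem lact_zero (a : A) : a ▷ (0 : M) = 0 := by simp [lact]
theorem zero_lact (m : M) : (0 : A) ▷ m = 0 := by simp [lact]
theorem neg_lact (a : A) (m : M) : (-a) ▷ m = -(a ▷ m) := by simp [lact]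
theorem lact_sub (a : A) (m m' : M) : a ▷ (m - m') = a ▷ m - a ▷ m' := by simp [lact]
theorem sub_lact (a a' : A) (m : M) : (a - a') ▷ m = a ▷ m - a' ▷ m := by simp [lact]
theorem lact_sum (a : A) (s : Finset ι) (m : ι → M) : a ▷ (∑ i ∈ s, m i) = ∑ i ∈ s, a ▷ m i := by
  simp [lact]
theorem sum_lact (s : Finset ι) (a : ι → A) (m : M) : (∑ i ∈ s, a i) ▷ m = ∑ i ∈ s, a i ▷ m := by
  simp [lact]
theorem ite_lact (p : Prop) [Decidable p] (m : M) :
    (if p then (1 : A) else 0) ▷ m = if p then m else 0 := by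
  split_ifs
  exacts [one_lact m, zero_lact m]
theorem sub_ract (m m' : M) (b : B) : (m - m') ◁ b = m ◁ b - m' ◁ b := by simp [ract]
theorem zero_ract (b : B) : (0 : M) ◁ b = 0 := by simp [ract]
theorem sum_ract (s : Finset ι) (m : ι → M) (b : B) : (∑ i ∈ s, m i) ◁ b = ∑ i ∈ s, m i ◁ b := by
  simp [ract]
theorem tmul_zero (m : M) : m ⊠ (0 : N) = 0 := map_zero _
theorem zero_tmul (n : N) : (0 : M) ⊠ n = 0 := LinearMap.map_zero₂ _ _
theorem tmul_neg (m : M) (n : N) : m ⊠ (-n) = -(m ⊠ n) := map_neg _ _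
theorem neg_tmul (m : M) (n : N) : (-m) ⊠ n = -(m ⊠ n) := LinearMap.map_neg₂ _ _ _
theorem tmul_sub (m : M) (n n' : N) : m ⊠ (n - n') = m ⊠ n - m ⊠ n' := map_sub _ _ _
theorem sub_tmul (m m' : M) (n : N) : (m - m') ⊠ n = m ⊠ n - m' ⊠ n :=
  LinearMap.map_sub₂ _ _ _ _
theorem tmul_sum (s : Finset ι) (m : M) (n : ι → N) : m ⊠ (∑ i ∈ s, n i) = ∑ i ∈ s, m ⊠ n i :=
  map_sum _ _ _
theorem sum_tmul (s : Finset ι) (m : ι → M) (n : N) : (∑ i ∈ s, m i) ⊠ n = ∑ i ∈ s, m i ⊠ n :=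
  LinearMap.map_sum₂ _ _ _ _

theorem BTensor.mapLeft_tmul {D M' : Type} [Ring D] [Algebra ℂ D] [AddCommGroup M'] [Module ℂ M']
    [Bimodule D B M'] (f : M →ₗ[ℂ] M') (hf : ∀ (m : M) (b : B), f (m ◁ b) = f m ◁ b) (m : M)
    (n : N) : BTensor.mapLeft f hf (m ⊠ n) = f m ⊠ n :=
  BTensor.lift_tmul _ _ _ _

section
variable {K : Type} [AddCommGroup K] [Module ℂ K] [Bimodule A C K] (f : BTensor M N →ₗ[ℂ] K)

theorem BTensor.map_lact (a : A) (h : ∀ m n, f ((a ▷ m) ⊠ n) = a ▷ f (m ⊠ n))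
    (z : BTensor M N) : f (a ▷ z) = a ▷ f z := by
  have : f.comp (Bimodule.left (B := C) a) = (Bimodule.left (B := C) a).comp f :=
    BTensor.hom_ext fun m n => (congrArg f (lact_tmul a m n)).trans (h m n)
  exact LinearMap.congr_fun this z

theorem BTensor.map_ract (c : C) (h : ∀ m n, f (m ⊠ (n ◁ c)) = f (m ⊠ n) ◁ c)
    (z : BTensor M N) : f (z ◁ c) = f z ◁ c := by
  have : f.comp (Bimodule.right (A := A) (op c)) = (Bimodule.right (A := A) (op c)).comp f :=
    BTensor.hom_ext fun m n => (congrArg f (tmul_ract m n c)).trans (h m n)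
  exact LinearMap.congr_fun this z

end
end Bimodules

section Central

variable {A Ω : Type} [Ring A] [Algebra ℂ A] [AddCommGroup Ω] [Module ℂ Ω] [Bimodule A A Ω]

/-- The element `τ` of a bimodule commutes with the algebra. -/
def IsCentral (τ : Ω) : Prop := ∀ a : A, τ ◁ a = a ▷ τ

theorem IsCentral.zero : IsCentral (0 : Ω) := fun a => by rw [zero_ract, lact_zero]

theorem IsCentral.smul {τ : Ω} (hτ : IsCentral τ) (c : ℂ) : IsCentral (c • τ) := fun a => by
  rw [smul_ract, lact_smul, hτ]

theorem IsCentral.tmul {τ ρ : Ω} (hτ : IsCentral τ) (hρ : IsCentral ρ) : IsCentral (τ ⊠ ρ) :=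
  fun a => by rw [tmul_ract, hρ, ← tmul_balanced, hτ, lact_tmul]

theorem IsCentral.tmul_lact {τ : Ω} (hτ : IsCentral τ) (a : A) (ξ : Ω) :
    τ ⊠ (a ▷ ξ) = a ▷ (τ ⊠ ξ) := by
  rw [← tmul_balanced, hτ, lact_tmul]

theorem Calculus.d_one (dA : Calculus A Ω) : dA.d 1 = 0 := by
  simpa only [mul_one, ract_one, one_lact, left_eq_add] using dA.leibniz 1 1

theorem Calculus.d_algebraMap (dA : Calculus A Ω) (c : ℂ) : dA.d (algebraMap ℂ A c) = 0 := by
  rw [Algebra.algebraMap_eq_smul_one, map_smul, dA.d_one, smul_zero]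

/-- A bimodule map from the one-forms to the algebra: the noncommutative counterpart of a vector
field, paired with one-forms. -/
structure BimoduleFunctional (A Ω : Type) [Ring A] [Algebra ℂ A] [AddCommGroup Ω] [Module ℂ Ω]
    [Bimodule A A Ω] extends Ω →ₗ[ℂ] A where
  map_lact' : ∀ (a : A) (ξ : Ω), toFun (a ▷ ξ) = a * toFun ξ
  map_ract' : ∀ (ξ : Ω) (a : A), toFun (ξ ◁ a) = toFun ξ * a

namespace BimoduleFunctional

instance : FunLike (BimoduleFunctional A Ω) Ω A where
  coe T := T.toFun
  coe_injective := by
    rintro ⟨f, _, _⟩ ⟨g, _, _⟩ h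
    congr
    exact DFunLike.coe_injective h

instance : LinearMapClass (BimoduleFunctional A Ω) ℂ Ω A where
  map_add T := T.map_add'
  map_smulₛₗ T := T.map_smul'

variable (T : BimoduleFunctional A Ω)

theorem map_lact (a : A) (ξ : Ω) : T (a ▷ ξ) = a * T ξ := T.map_lact' a ξ
theorem map_ract (ξ : Ω) (a : A) : T (ξ ◁ a) = T ξ * a := T.map_ract' ξ a

/-- The square `T ⊗ T` of a functional, `ξ ⊗ ζ ↦ T(ξ) T(ζ)`. -/
def square : BTensor Ω Ω →ₗ[ℂ] A :=
  BTensor.lift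
    (LinearMap.mk₂ ℂ (fun ξ ζ => T ξ * T ζ)
      (fun ξ ξ' ζ => by rw [map_add, add_mul])
      (fun c ξ ζ => by rw [map_smul, smul_mul_assoc])
      (fun ξ ζ ζ' => by rw [map_add, mul_add])
      (fun c ξ ζ => by rw [map_smul, mul_smul_comm]))
    (fun ξ a ζ => by simp only [LinearMap.mk₂_apply, map_ract, map_lact, mul_assoc])

theorem square_tmul (ξ ζ : Ω) : T.square (ξ ⊠ ζ) = T ξ * T ζ := BTensor.lift_tmul _ _ _ _

theorem square_lact (a : A) (z : BTensor Ω Ω) : T.square (a ▷ z) = a * T.square z := by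
  have : T.square.comp (Bimodule.left (B := A) a) = (LinearMap.mulLeft ℂ a).comp T.square :=
    BTensor.hom_ext fun ξ ζ => by
      change T.square (a ▷ (ξ ⊠ ζ)) = a * T.square (ξ ⊠ ζ)
      rw [lact_tmul, square_tmul, square_tmul, map_lact, mul_assoc]
  exact LinearMap.congr_fun this z

end BimoduleFunctional

/-! ## Connections that flip a central frame -/

/-- A finite basis of central elements `e_i` of a bimodule, together with its coordinates
`ξ = ξ^i e_i`, which are bimodule maps. -/
structure CentralFrame (ι A Ω : Type) [Fintype ι] [DecidableEq ι] [Ring A] [Algebra ℂ A]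
    [AddCommGroup Ω] [Module ℂ Ω] [Bimodule A A Ω] where
  vec : ι → Ω
  coord : ι → BimoduleFunctional A Ω
  central : ∀ i, IsCentral (vec i)
  expand : ∀ ξ, ∑ i, coord i ξ ▷ vec i = ξ
  coord_vec : ∀ i j, coord i (vec j) = if j = i then 1 else 0

namespace CentralFrame

variable {ι : Type} [Fintype ι] [DecidableEq ι]

theorem ract_eq_lact_of_mem_center (e : CentralFrame ι A Ω) {z : A} (hz : z ∈ Set.center A)
    (ξ : Ω) : ξ ◁ z = z ▷ ξ := by
  rw [← e.expand ξ]
  simp only [sum_ract, lact_sum, ← lact_ract, e.central _ _, ← mul_lact,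
    (Semigroup.mem_center_iff.1 hz _)]

variable (e : CentralFrame ι A Ω)

/-- The braiding `ξ ⊗ ζ ↦ Σ_i e_i ⊗ ξ ζ^i`, which flips two frame elements. -/
def flip : BTensor Ω Ω →ₗ[ℂ] BTensor Ω Ω :=
  BTensor.lift
    (LinearMap.mk₂ ℂ (fun ξ ζ => ∑ i, e.vec i ⊠ (ξ ◁ e.coord i ζ))
      (fun ξ ξ' ζ => by simp only [add_ract, tmul_add, Finset.sum_add_distrib])
      (fun c ξ ζ => by simp only [smul_ract, tmul_smul, Finset.smul_sum])
      (fun ξ ζ ζ' => by simp only [map_add, ract_add, tmul_add, Finset.sum_add_distrib])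
      (fun c ξ ζ => by simp only [map_smul, ract_smul, tmul_smul, Finset.smul_sum]))
    (fun ξ a ζ => by
      simp only [LinearMap.mk₂_apply, BimoduleFunctional.map_lact, ract_mul])

theorem flip_tmul (ξ ζ : Ω) : e.flip (ξ ⊠ ζ) = ∑ i, e.vec i ⊠ (ξ ◁ e.coord i ζ) :=
  BTensor.lift_tmul _ _ _ _

theorem flip_lact (a : A) (z : BTensor Ω Ω) : e.flip (a ▷ z) = a ▷ e.flip z :=
  BTensor.map_lact _ _ (fun ξ ζ => by
    simp only [flip_tmul, lact_sum, ← lact_ract, (e.central _).tmul_lact]) z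

theorem flip_ract (z : BTensor Ω Ω) (a : A) : e.flip (z ◁ a) = e.flip z ◁ a :=
  BTensor.map_ract _ _ (fun ξ ζ => by
    simp only [flip_tmul, sum_ract, BimoduleFunctional.map_ract, ract_mul, tmul_ract]) z

theorem flip_central_left {ξ : Ω} (hξ : IsCentral ξ) (ζ : Ω) : e.flip (ξ ⊠ ζ) = ζ ⊠ ξ := by
  simp only [flip_tmul, hξ _, ← tmul_balanced, e.central _ _]
  rw [← sum_tmul, e.expand]

theorem coord_mem_center {ζ : Ω} (hζ : IsCentral ζ) (i : ι) : e.coord i ζ ∈ Set.center A :=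
  Semigroup.mem_center_iff.2 fun a => by
    rw [← BimoduleFunctional.map_ract, hζ, BimoduleFunctional.map_lact]

theorem flip_central_right (ξ : Ω) {ζ : Ω} (hζ : IsCentral ζ) : e.flip (ξ ⊠ ζ) = ζ ⊠ ξ := by
  simp only [flip_tmul, e.ract_eq_lact_of_mem_center (e.coord_mem_center hζ _), ← tmul_balanced]
  rw [← sum_tmul, e.expand]

theorem tmul_eq_sum (ξ ζ : Ω) : ξ ⊠ ζ = ∑ i, e.vec i ⊠ (e.coord i ξ ▷ ζ) := by
  simp only [← tmul_balanced, e.central _ _]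
  rw [← sum_tmul, e.expand]

/-- The covariant derivative `∇ξ = e_i ⊗ dξ^i + ξ^i N_i`; as `e_i` is central, `e_i ⊗ dξ^i` is the
flip of `dξ^i ⊗ e_i`. -/
def nabla (dA : Calculus A Ω) (N : ι → BTensor Ω Ω) : Ω →ₗ[ℂ] BTensor Ω Ω where
  toFun ξ := ∑ i, (e.vec i ⊠ dA.d (e.coord i ξ) + e.coord i ξ ▷ N i)
  map_add' ξ ζ := by
    simp only [map_add, tmul_add, add_lact, ← Finset.sum_add_distrib, add_add_add_comm]
  map_smul' c ξ := by
    simp only [map_smul, tmul_smul, smul_lact, Finset.smul_sum, smul_add, RingHom.id_apply]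

theorem nabla_apply (dA : Calculus A Ω) (N : ι → BTensor Ω Ω) (ξ : Ω) :
    e.nabla dA N ξ = ∑ i, (e.vec i ⊠ dA.d (e.coord i ξ) + e.coord i ξ ▷ N i) := rfl

/-- The connection `∇e_i = N_i`, with central `N_i`, whose braiding is the flip of the frame. -/
def connection (dA : Calculus A Ω) (N : ι → BTensor Ω Ω) (hN : ∀ i, IsCentral (N i)) :
    BimoduleConnection dA dA Ω where
  nabla := e.nabla dA N
  sigma := e.flip
  sigma_left := e.flip_lact
  sigma_right := e.flip_ract
  right_leibniz ξ a := by
    simp only [nabla_apply, BimoduleFunctional.map_ract, dA.leibniz, tmul_add, mul_lact,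
      ← hN _ a, lact_ract, e.tmul_eq_sum ξ, sum_ract, add_ract, tmul_ract,
      ← Finset.sum_add_distrib]
    exact Finset.sum_congr rfl fun i _ => add_right_comm _ _ _
  left_leibniz a ξ := by
    simp only [nabla_apply, flip_tmul, BimoduleFunctional.map_lact, dA.leibniz, tmul_add,
      mul_lact, lact_sum, lact_add, ← Finset.sum_add_distrib, (e.central _).tmul_lact]
    refine Finset.sum_congr rfl fun i _ => ?_
    abel

theorem nabla_vec (dA : Calculus A Ω) (N : ι → BTensor Ω Ω) (j : ι) :
    e.nabla dA N (e.vec j) = N j := by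
  have hd (p : Prop) [Decidable p] : dA.d (if p then 1 else 0) = 0 := by
    split_ifs
    exacts [dA.d_one, map_zero _]
  simp only [nabla_apply, e.coord_vec, hd, tmul_zero, zero_add, ite_lact, Finset.sum_ite_eq,
    Finset.mem_univ, if_true]

theorem square_coord_nabla (dA : Calculus A Ω) {N : ι → BTensor Ω Ω} {j : ι}
    (hN : ∀ i, (e.coord j).square (N i) = 0) (ξ : Ω) :
    (e.coord j).square (e.nabla dA N ξ) = e.coord j (dA.d (e.coord j ξ)) := by
  simp only [nabla_apply, map_sum, map_add, BimoduleFunctional.square_tmul,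
    BimoduleFunctional.square_lact, e.coord_vec, hN, ite_mul, one_mul, zero_mul, mul_zero,
    add_zero, Finset.sum_ite_eq', Finset.mem_univ, if_true]

end CentralFrame
end Central

/-! ## Connections along a vector field -/

section Evolution

variable {A B ΩA ΩB : Type} [Ring A] [Algebra ℂ A] [Ring B] [Algebra ℂ B]
  [AddCommGroup ΩA] [Module ℂ ΩA] [Bimodule A A ΩA]
  [AddCommGroup ΩB] [Module ℂ ΩB] [Bimodule B B ΩB]

/-- The map `ξ ⊗ φ ↦ T(ξ) φ ⊗ τ`. -/
def BimoduleFunctional.braiding (T : BimoduleFunctional A ΩA) (E : Type) [AddCommGroup E]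
    [Module ℂ E] [Bimodule A B E] (τ : ΩB) : BTensor ΩA E →ₗ[ℂ] BTensor E ΩB :=
  BTensor.lift
    (LinearMap.mk₂ ℂ (fun ξ φ => (T ξ ▷ φ) ⊠ τ)
      (fun ξ ξ' φ => by rw [map_add, add_lact, add_tmul])
      (fun c ξ φ => by rw [map_smul, smul_lact, smul_tmul])
      (fun ξ φ φ' => by rw [lact_add, add_tmul])
      (fun c ξ φ => by rw [lact_smul, smul_tmul]))
    (fun ξ a φ => by
      change (T (ξ ◁ a) ▷ φ) ⊠ τ = (T ξ ▷ a ▷ φ) ⊠ τ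
      rw [T.map_ract, mul_lact])

theorem BimoduleFunctional.braiding_tmul (T : BimoduleFunctional A ΩA) {E : Type}
    [AddCommGroup E] [Module ℂ E] [Bimodule A B E] (τ : ΩB) (ξ : ΩA) (φ : E) :
    T.braiding E τ (ξ ⊠ φ) = (T ξ ▷ φ) ⊠ τ := BTensor.lift_tmul _ _ _ _

/-- An operator on an `A`-`B`-bimodule that is a derivation along the functional `T` with respect
to the left action, and along the central form `τ` with respect to the right action. -/
structure EvolutionOperator (dA : Calculus A ΩA) (dB : Calculus B ΩB)
    (T : BimoduleFunctional A ΩA) (τ : ΩB) (E : Type) [AddCommGroup E] [Module ℂ E]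
    [Bimodule A B E] extends E →ₗ[ℂ] E where
  map_lact' : ∀ (a : A) (φ : E), toFun (a ▷ φ) = a ▷ toFun φ + T (dA.d a) ▷ φ
  map_ract' : ∀ (φ : E) (b : B), toFun (φ ◁ b) ⊠ τ = (toFun φ ◁ b) ⊠ τ + φ ⊠ dB.d b

namespace EvolutionOperator

variable {dA : Calculus A ΩA} {dB : Calculus B ΩB} {T : BimoduleFunctional A ΩA} {τ : ΩB}
  {E : Type} [AddCommGroup E] [Module ℂ E] [Bimodule A B E] (K : EvolutionOperator dA dB T τ E)

/-- The bimodule connection `∇φ = Kφ ⊗ τ` with braiding `ξ ⊗ φ ↦ T(ξ) φ ⊗ τ`. -/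
def connection (hτ : IsCentral τ) : BimoduleConnection dA dB E where
  nabla := ((tmulₗ E ΩB).flip τ).comp K.toLinearMap
  sigma := T.braiding E τ
  sigma_left a := BTensor.map_lact _ a fun ξ φ => by
    rw [T.braiding_tmul, T.braiding_tmul, T.map_lact, mul_lact, lact_tmul]
  sigma_right z b := BTensor.map_ract _ b (fun ξ φ => by
    rw [T.braiding_tmul, T.braiding_tmul, lact_ract, tmul_ract, hτ b, tmul_balanced]) z
  right_leibniz φ b :=
    (K.map_ract' φ b).trans (by rw [tmul_balanced, ← hτ b, ← tmul_ract]; rfl)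
  left_leibniz a φ := by
    change K.toLinearMap (a ▷ φ) ⊠ τ = a ▷ (K.toLinearMap φ ⊠ τ) + _
    rw [T.braiding_tmul, lact_tmul, ← add_tmul]
    exact congrArg (· ⊠ τ) (K.map_lact' a φ)

variable (hτ : IsCentral τ)

theorem connection_nabla (φ : E) : (K.connection hτ).nabla φ = K.toLinearMap φ ⊠ τ := rfl

theorem connection_sigma_tmul (ξ : ΩA) (φ : E) :
    (K.connection hτ).sigma (ξ ⊠ φ) = (T ξ ▷ φ) ⊠ τ := T.braiding_tmul τ ξ φ

theorem mapLeft_sigma_idSigma (z : BTensor ΩA ΩA) (φ : E) :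
    BTensor.mapLeft (K.connection hτ).sigma (K.connection hτ).sigma_right
        (idSigma ΩA (K.connection hτ) φ z) = ((T.square z ▷ φ) ⊠ τ) ⊠ τ := by
  have : (BTensor.mapLeft (K.connection hτ).sigma (K.connection hτ).sigma_right).comp
        (idSigma ΩA (K.connection hτ) φ)
      = ((tmulₗ (BTensor E ΩB) ΩB).flip τ).comp (((tmulₗ E ΩB).flip τ).comp
          ((Bimodule.left (A := A) (B := B) (M := E)).toLinearMap.flip φ |>.comp T.square)) :=
    BTensor.hom_ext fun ξ ζ => by
      change BTensor.mapLeft _ (K.connection hτ).sigma_right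
          (idSigma ΩA (K.connection hτ) φ (ξ ⊠ ζ))
        = ((T.square (ξ ⊠ ζ) ▷ φ) ⊠ τ) ⊠ τ
      rw [idSigma_tmul, connection_sigma_tmul, BTensor.reassoc_tmul, BTensor.mapLeft_tmul,
        connection_sigma_tmul, T.square_tmul, mul_lact]
  exact LinearMap.congr_fun this z

theorem doubleNabla_tmul (cA : BimoduleConnection dA dA ΩA) (cB : BimoduleConnection dB dB ΩB)
    (hnabla : cB.nabla τ = 0) (hsigma : cB.sigma (τ ⊠ τ) = τ ⊠ τ) (ξ : ΩA) (φ : E) :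
    doubleNabla cA cB (K.connection hτ) (ξ ⊠ φ)
      = (((T (dA.d (T ξ)) - T.square (cA.nabla ξ)) ▷ φ) ⊠ τ) ⊠ τ := by
  have hK : K.toLinearMap (T ξ ▷ φ) = T ξ ▷ K.toLinearMap φ + T (dA.d (T ξ)) ▷ φ :=
    K.map_lact' (T ξ) φ
  rw [doubleNabla, LinearMap.sub_apply, LinearMap.comp_apply, LinearMap.comp_apply,
    connection_sigma_tmul, tensorNabla_tmul, tensorNabla_tmul, hnabla, tmul_zero, map_zero,
    add_zero, connection_nabla, connection_nabla, idSigma_tmul, hsigma, hK, map_add,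
    mapLeft_sigma_idSigma, BTensor.reassoc_tmul, BTensor.reassoc_tmul, BTensor.mapLeft_tmul,
    connection_sigma_tmul]
  simp only [add_tmul, sub_lact, sub_tmul]
  abel

theorem doubleNabla_eq_zero (cA : BimoduleConnection dA dA ΩA)
    (cB : BimoduleConnection dB dB ΩB) (hnabla : cB.nabla τ = 0)
    (hsigma : cB.sigma (τ ⊠ τ) = τ ⊠ τ)
    (hT : ∀ ξ, T.square (cA.nabla ξ) = T (dA.d (T ξ))) :
    doubleNabla cA cB (K.connection hτ) = 0 :=
  BTensor.hom_ext fun ξ φ => by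
    rw [doubleNabla_tmul K hτ cA cB hnabla hsigma, hT, sub_self, zero_lact, zero_tmul, zero_tmul,
      LinearMap.zero_apply]

end EvolutionOperator
end Evolution

theorem fderiv_fderiv_apply_comm {V W : Type*} [NormedAddCommGroup V] [NormedSpace ℝ V]
    [NormedAddCommGroup W] [NormedSpace ℝ W] {f : V → W} (hf : ContDiff ℝ 2 f) (v w x : V) :
    fderiv ℝ (fun y => fderiv ℝ f y v) x w = fderiv ℝ (fun y => fderiv ℝ f y w) x v := by
  have hd : DifferentiableAt ℝ (fderiv ℝ f) x :=
    (hf.fderiv_right (m := 1) (by norm_num)).differentiable (by simp) x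
  have happly (v w : V) : fderiv ℝ (fun y => fderiv ℝ f y v) x w
      = fderiv ℝ (fderiv ℝ f) x w v := by
    rw [fderiv_clm_apply hd (differentiableAt_const v)]
    simp
  rw [happly, happly]
  exact hf.contDiffAt.isSymmSndFDerivAt (by simp [minSmoothness_of_isRCLikeNormedField]) w v

section Metric

variable {M : Type*} [AddCommMonoid M] [Module ℂ M]

theorem eta_of_ne {a b : Fin 4} (h : a ≠ b) : eta a b = 0 := if_neg h

theorem sum_eta_smul (a : Fin 4) (m : Fin 4 → M) : ∑ b, eta a b • m b = eta a a • m a :=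
  Finset.sum_eq_single_of_mem a (Finset.mem_univ a) fun b _ h => by
    rw [eta_of_ne h.symm, zero_smul]

theorem sum_eta_smul' (a : Fin 4) (m : Fin 4 → M) : ∑ b, eta b a • m b = eta a a • m a :=
  Finset.sum_eq_single_of_mem a (Finset.mem_univ a) fun b _ h => by rw [eta_of_ne h, zero_smul]

end Metric

/-! ## Relations of the Heisenberg algebra -/

variable {P : Background}

namespace Background

theorem m_ne' : P.mc ≠ 0 := Complex.ofReal_ne_zero.2 P.m_ne

theorem differentiable_fn (f : P.Fn) : Differentiable ℝ f.1 :=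
  (P.fn_smooth f.1 f.2).differentiable (by simp)

variable (P) in
/-- The partial derivative `f ↦ f_{,a}` as a linear map. -/
def pdₗ (a : Fin 4) : P.Fn →ₗ[ℂ] P.Fn where
  toFun := P.pd a
  map_add' f g := by
    ext x
    change fderiv ℝ (f.1 + g.1) x _ = fderiv ℝ f.1 x _ + fderiv ℝ g.1 x _
    rw [fderiv_add (differentiable_fn f x) (differentiable_fn g x), add_apply]
  map_smul' c f := by
    ext x
    change fderiv ℝ (c • f.1) x _ = c • fderiv ℝ f.1 x _
    rw [fderiv_const_smul (differentiable_fn f x), smul_apply]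

theorem pd_neg (a : Fin 4) (f : P.Fn) : P.pd a (-f) = -P.pd a f := map_neg (P.pdₗ a) f

theorem pd_comm (a b : Fin 4) (f : P.Fn) : P.pd a (P.pd b f) = P.pd b (P.pd a f) :=
  Subtype.ext <| funext fun x =>
    fderiv_fderiv_apply_comm ((P.fn_smooth f.1 f.2).of_le ENat.LEInfty.out) _ _ x

theorem pd_coord (a b : Fin 4) : P.pd a (P.coord b) = if a = b then 1 else 0 := by
  ext x
  let L : Spacetime →L[ℝ] ℂ :=
    Complex.ofRealCLM.comp (ContinuousLinearMap.proj (R := ℝ) (φ := fun _ : Fin 4 => ℝ) b)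
  have h : HasFDerivAt (fun x : Spacetime => (x b : ℂ)) L x := L.hasFDerivAt
  change fderiv ℝ (fun x : Spacetime => (x b : ℂ)) x (Pi.single a 1) = _
  rw [h.fderiv]
  obtain rfl | hab := eq_or_ne a b
  · simp [L]
  · simp [L, hab]

theorem pd_pd_coord (a b c : Fin 4) : P.pd a (P.pd b (P.coord c)) = 0 := by
  have pd_one : P.pd a 1 = 0 := Subtype.ext <| funext fun x =>
    DFunLike.congr_fun (fderiv_const_apply (𝕜 := ℝ) (x := x) (1 : ℂ)) _
  rw [pd_coord, apply_ite (P.pd a), pd_one, show P.pd a 0 = 0 from map_zero (P.pdₗ a), ite_self]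

theorem F_antisymm (a b : Fin 4) : P.F a b = -P.F b a :=
  Subtype.ext <| funext fun _ => (neg_sub _ _).symm

theorem F1_antisymm (a b c : Fin 4) : P.F1 a b c = -P.F1 b a c := by
  rw [F1, F_antisymm, pd_neg, F1]

theorem F2_comm (a b c d : Fin 4) : P.F2 a b c d = P.F2 a b d c := pd_comm _ _ _

end Background

variable (P) in
/-- The inclusion of the functions of `x` into the Heisenberg algebra. -/
def fnHom : P.Fn →ₐ[ℂ] Heis P where
  toFun := fnH
  map_one' := by
    have h := RingQuot.mkAlgHom_rel ℂ (HeisRel.fn_const (P := P) 1)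
    rwa [AlgHom.commutes, map_one, map_one] at h
  map_mul' f g := (RingQuot.mkAlgHom_rel ℂ (HeisRel.fn_mul f g)).trans (map_mul _ _ _)
  map_zero' := by
    have h := RingQuot.mkAlgHom_rel ℂ (HeisRel.fn_const (P := P) 0)
    rwa [AlgHom.commutes, map_zero, map_zero] at h
  map_add' f g := (RingQuot.mkAlgHom_rel ℂ (HeisRel.fn_add f g)).trans (map_add _ _ _)
  commutes' c :=
    (RingQuot.mkAlgHom_rel ℂ (HeisRel.fn_const (P := P) c)).trans (AlgHom.commutes _ c)

theorem fnH_zero : fnH (0 : P.Fn) = 0 := map_zero (fnHom P)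
theorem fnH_one : fnH (1 : P.Fn) = 1 := map_one (fnHom P)
theorem fnH_neg (f : P.Fn) : fnH (-f) = -fnH f := map_neg (fnHom P) f
theorem fnH_add (f g : P.Fn) : fnH (f + g) = fnH f + fnH g := map_add (fnHom P) f g
theorem fnH_sub (f g : P.Fn) : fnH (f - g) = fnH f - fnH g := map_sub (fnHom P) f g
theorem fnH_mul (f g : P.Fn) : fnH (f * g) = fnH f * fnH g := map_mul (fnHom P) f g
theorem fnH_smul (c : ℂ) (f : P.Fn) : fnH (c • f) = c • fnH f := map_smul (fnHom P) c f
theorem fnH_sum {ι : Type*} (s : Finset ι) (f : ι → P.Fn) :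
    fnH (∑ i ∈ s, f i) = ∑ i ∈ s, fnH (f i) := map_sum (fnHom P) f s

theorem fnH_comm (f g : P.Fn) : fnH f * fnH g = fnH g * fnH f := by
  rw [← fnH_mul, mul_comm, fnH_mul]

theorem fnH_mul_pH (f : P.Fn) (a : Fin 4) :
    fnH f * pH P a = pH P a * fnH f + (I * P.ħ) • fnH (P.pd a f) := by
  have h := RingQuot.mkAlgHom_rel ℂ (HeisRel.fn_p (P := P) f a)
  rw [map_sub, map_mul, map_mul, map_smul] at h
  exact sub_eq_iff_eq_add'.1 h

theorem pH_mul_fnH (f : P.Fn) (a : Fin 4) :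
    pH P a * fnH f = fnH f * pH P a - (I * P.ħ) • fnH (P.pd a f) := by
  rw [fnH_mul_pH, add_sub_cancel_right]

theorem pH_mul_pH (a b : Fin 4) :
    pH P a * pH P b = pH P b * pH P a + (I * P.ħ * P.qc) • fnH (P.F a b) := by
  have h := RingQuot.mkAlgHom_rel ℂ (HeisRel.p_p (P := P) a b)
  rw [map_sub, map_mul, map_mul, map_smul] at h
  exact sub_eq_iff_eq_add'.1 h

theorem Heis.induction {p : Heis P → Prop} (const : ∀ c : ℂ, p (algebraMap ℂ _ c))
    (fn : ∀ f, p (fnH f)) (mom : ∀ a, p (pH P a)) (add : ∀ a b, p a → p b → p (a + b))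
    (mul : ∀ a b, p a → p b → p (a * b)) (a : Heis P) : p a := by
  obtain ⟨u, rfl⟩ := RingQuot.mkAlgHom_surjective ℂ (HeisRel P) a
  induction u using FreeAlgebra.induction with
  | grade0 r => rw [AlgHom.commutes]; exact const r
  | grade1 x => rcases x with f | c; exacts [fn f, mom c]
  | mul u v hu hv => rw [map_mul]; exact mul _ _ hu hv
  | add u v hu hv => rw [map_add]; exact add _ _ hu hv

/-! ## Relations of the calculus -/

theorem toΩ_lact (a : Heis P) (ξ : FreeForm P) : toΩ P (freeL a ξ) = a ▷ toΩ P ξ := rfl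
theorem toΩ_ract (a : Heis P) (ξ : FreeForm P) : toΩ P (freeR ξ a) = toΩ P ξ ◁ a := rfl
theorem toΩ_add (ξ ζ : FreeForm P) : toΩ P (ξ + ζ) = toΩ P ξ + toΩ P ζ := rfl
theorem toΩ_sub (ξ ζ : FreeForm P) : toΩ P (ξ - ζ) = toΩ P ξ - toΩ P ζ := rfl
theorem toΩ_smul (c : ℂ) (ξ : FreeForm P) : toΩ P (c • ξ) = c • toΩ P ξ := rfl
theorem toΩ_sum {ι : Type*} (s : Finset ι) (ξ : ι → FreeForm P) :
    toΩ P (∑ i ∈ s, ξ i) = ∑ i ∈ s, toΩ P (ξ i) := map_sum (formRelations P).mkQ _ _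

theorem toΩ_freeComm (a : Heis P) (ξ : FreeForm P) :
    toΩ P (freeComm ξ a) = toΩ P ξ ◁ a - a ▷ toΩ P ξ := rfl

theorem isCentral_theta : IsCentral (θ P) := fun a => by
  have h := toΩ_eq P (ζ := 0) (by rw [sub_zero]; exact FormRel.theta_central a)
  rw [toΩ_freeComm] at h
  exact sub_eq_zero.1 h

theorem d_fnH (f : P.Fn) : (heisCalculus P).d (fnH f)
    = ∑ a, fnH (P.pd a f) ▷ dx P a
      - (I * P.ħ / (2 * P.mc)) • ∑ a, eta a a • fnH (P.pd a (P.pd a f)) ▷ θ P := by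
  have h := toΩ_eq P (FormRel.d_fn f)
  simp only [toΩ_sub, toΩ_sum, toΩ_smul, toΩ_lact, sum_eta_smul] at h
  exact h

theorem dx_ract_fnH (a : Fin 4) (f : P.Fn) : dx P a ◁ fnH f
    = fnH f ▷ dx P a - (I * P.ħ / P.mc * eta a a) • fnH (P.pd a f) ▷ θ P := by
  have h := toΩ_eq P (FormRel.dx_fn a f)
  simp only [toΩ_freeComm, toΩ_smul, toΩ_lact, sum_eta_smul] at h
  rw [mul_smul, sub_eq_add_neg, ← neg_smul]
  exact sub_eq_iff_eq_add'.1 h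

theorem dx_ract_pH (a c : Fin 4) : dx P a ◁ pH P c
    = pH P c ▷ dx P a + (I * P.ħ * P.qc / P.mc * eta a a) • fnH (P.F a c) ▷ θ P := by
  have h := toΩ_eq P (FormRel.dx_p a c)
  simp only [toΩ_freeComm, toΩ_smul, toΩ_lact, sum_eta_smul] at h
  rw [mul_smul]
  exact sub_eq_iff_eq_add'.1 h

theorem dp_ract_fnH (c : Fin 4) (f : P.Fn) : dp P c ◁ fnH f
    = fnH f ▷ dp P c
      + (I * P.ħ * P.qc / P.mc) • ∑ a, eta a a • fnH (P.F a c * P.pd a f) ▷ θ P := by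
  have h := toΩ_eq P (FormRel.dp_fn c f)
  simp only [toΩ_freeComm, toΩ_sum, toΩ_smul, toΩ_lact, sum_eta_smul] at h
  exact sub_eq_iff_eq_add'.1 h

theorem dp_ract_pH (c d : Fin 4) : dp P c ◁ pH P d
    = pH P d ▷ dp P c - (I * P.ħ * P.qc) • ∑ a, fnH (P.F1 a c d) ▷ dx P a
      + (I * P.ħ * P.qc / (2 * P.mc)) • ∑ a, eta a a •
          ((I * P.ħ) • fnH (P.F2 a c a d) ▷ θ P
            - (2 * P.qc) • (fnH (P.F a c) * fnH (P.F a d)) ▷ θ P) := by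
  have h := toΩ_eq P (FormRel.dp_p c d)
  simp only [toΩ_freeComm, toΩ_sum, toΩ_sub, toΩ_smul, toΩ_lact, sum_eta_smul] at h
  refine (sub_eq_iff_eq_add'.1 h).trans ?_
  rw [neg_smul, ← add_sub_assoc, ← sub_eq_add_neg, sub_eq_add_neg (_ - _)]
  congr 1
  simp only [Finset.smul_sum, ← Finset.sum_neg_distrib]
  refine Finset.sum_congr rfl fun a _ => ?_
  simp only [fnH_add, fnH_smul, fnH_mul, add_lact, smul_lact,
    show toΩ P (symTheta P) = θ P from rfl]
  match_scalars
  · linear_combination (-(P.ħ ^ 2 * P.qc / (2 * P.mc) * eta a a)) * Complex.I_sq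
  · ring

theorem Env.induction {p : Env P → Prop} (zero : p 0)
    (mul : ∀ (a : Heis P) (b : (Heis P)ᵐᵒᵖ), p (envL P a * envR P b))
    (add : ∀ x y, p x → p y → p (x + y)) (e : Env P) : p e := by
  refine TensorProduct.induction_on (motive := p) e zero (fun a b => ?_) add
  have hab : envL P a * envR P b = (a ⊗ₜ[ℂ] b : Heis P ⊗[ℂ] (Heis P)ᵐᵒᵖ) :=
    (Algebra.TensorProduct.tmul_mul_tmul _ _ _ _).trans (by rw [mul_one, one_mul])
  exact hab ▸ mul a b

theorem Form.induction_d {p : Form P → Prop} (zero : p 0)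
    (add : ∀ ξ ζ, p ξ → p ζ → p (ξ + ζ)) (lact : ∀ (a : Heis P) ξ, p ξ → p (a ▷ ξ))
    (ract : ∀ (a : Heis P) ξ, p ξ → p (ξ ◁ a)) (d : ∀ a, p ((heisCalculus P).d a))
    (theta : p (θ P)) (ξ : Form P) : p ξ := by
  obtain ⟨u, rfl⟩ := (formRelations P).mkQ_surjective ξ
  change p (toΩ P u)
  induction u using Finsupp.induction_linear with
  | zero => exact zero
  | add u v hu hv => rw [toΩ_add]; exact add _ _ hu hv
  | single g e =>
    have hg : p (toΩ P (Finsupp.single g 1)) := by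
      rcases g with a | _
      exacts [d a, theta]
    induction e using Env.induction with
    | zero => rw [Finsupp.single_zero]; exact zero
    | add x y hx hy => rw [Finsupp.single_add, toΩ_add]; exact add _ _ hx hy
    | mul a b =>
      have h : (Finsupp.single g (envL P a * envR P b) : FreeForm P)
          = freeL a (freeR (Finsupp.single g 1) b.unop) := by
        rw [freeL, freeR, Finsupp.smul_single, Finsupp.smul_single, smul_eq_mul, smul_eq_mul,
          mul_one, MulOpposite.op_unop]
      rw [h, toΩ_lact, toΩ_ract]
      exact lact _ _ (ract _ _ hg)

theorem Form.induction {p : Form P → Prop} (add : ∀ ξ ζ, p ξ → p ζ → p (ξ + ζ))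
    (lact : ∀ (a : Heis P) ξ, p ξ → p (a ▷ ξ)) (ract : ∀ (a : Heis P) ξ, p ξ → p (ξ ◁ a))
    (dx : ∀ a, p (dx P a)) (dp : ∀ a, p (dp P a)) (theta : p (θ P)) (ξ : Form P) : p ξ := by
  have zero : p 0 := zero_lact (A := Heis P) (θ P) ▸ lact 0 _ theta
  have sum (u : Fin 4 → Form P) (hu : ∀ a, p (u a)) : p (∑ a, u a) :=
    Finset.sum_induction u p add zero fun a _ => hu a
  have smul (c : ℂ) (ζ : Form P) (hζ : p ζ) : p (c • ζ) := by
    rw [← one_lact (A := Heis P) ζ, ← smul_lact]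
    exact lact _ _ hζ
  refine Form.induction_d zero add lact ract (fun a => ?_) theta ξ
  induction a using Heis.induction with
  | const c => rw [Calculus.d_algebraMap]; exact zero
  | fn f =>
    rw [d_fnH, sub_eq_add_neg, ← neg_smul]
    exact add _ _ (sum _ fun a => lact _ _ (dx a))
      (smul _ _ (sum _ fun a => smul _ _ (lact _ _ theta)))
  | mom a => exact dp a
  | add a b ha hb => rw [map_add]; exact add _ _ ha hb
  | mul a b ha hb => rw [(heisCalculus P).leibniz]; exact add _ _ (ract _ _ ha) (lact _ _ hb)

attribute [local instance 100] LieRing.ofAssociativeRing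

/-! ## Inner derivations as bimodule maps -/

instance : Module (Env P) (Heis P) :=
  Module.compHom (Heis P) (AlgHom.mulLeftRight ℂ (Heis P)).toRingHom

theorem envL_smul (a b : Heis P) : envL P a • b = a * b :=
  (AlgHom.mulLeftRight_apply ℂ (Heis P) a 1 b).trans (mul_one _)

theorem envR_smul (a b : Heis P) : envR P (op a) • b = b * a :=
  (AlgHom.mulLeftRight_apply ℂ (Heis P) 1 (op a) b).trans (by rw [one_mul, MulOpposite.unop_op])

instance : IsScalarTower ℂ (Env P) (Heis P) where
  smul_assoc c e b := LinearMap.congr_fun (map_smul (AlgHom.mulLeftRight ℂ (Heis P)) c e) b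

/-- The inner derivation `[w, ·]` of the Heisenberg algebra, together with the value `t` for `θ'`,
respects the defining relations of the calculus, so that `da ↦ [w, a]`, `θ' ↦ t` extends to a
bimodule map on one-forms. -/
structure InnerCompatible (w : Heis P) (t : ℂ) : Prop where
  d_fn : ∀ f : P.Fn, ⁅w, fnH f⁆ = ∑ a, fnH (P.pd a f) * ⁅w, xH P a⁆
      - (I * P.ħ / (2 * P.mc) * t) • ∑ a, eta a a • fnH (P.pd a (P.pd a f))
  dx_fn : ∀ (a : Fin 4) (f : P.Fn),
    ⁅⁅w, xH P a⁆, fnH f⁆ = -(I * P.ħ / P.mc * t * eta a a) • fnH (P.pd a f)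
  dx_p : ∀ a c : Fin 4,
    ⁅⁅w, xH P a⁆, pH P c⁆ = (I * P.ħ * P.qc / P.mc * t * eta a a) • fnH (P.F a c)
  dp_fn : ∀ (c : Fin 4) (f : P.Fn), ⁅⁅w, pH P c⁆, fnH f⁆
    = (I * P.ħ * P.qc / P.mc * t) • ∑ a, eta a a • (fnH (P.F a c) * fnH (P.pd a f))
  dp_p : ∀ c d : Fin 4, ⁅⁅w, pH P c⁆, pH P d⁆
    = -(I * P.ħ * P.qc) • ∑ a, fnH (P.F1 a c d) * ⁅w, xH P a⁆
      - (P.ħ * P.qc / (2 * P.mc) * t) • ∑ a, eta a a •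
          (P.ħ • fnH (P.F2 a c a d) + (2 * I * P.qc) • (fnH (P.F a c) * fnH (P.F a d)))

/-- The values `da ↦ [w, a]`, `θ' ↦ t` on the symbols that generate the one-forms. -/
def genValue (w : Heis P) (t : ℂ) : FormGen P → Heis P
  | .d a => ⁅w, a⁆
  | .theta => t • 1

/-- The bimodule map on the free bimodule that extends `genValue`. -/
def freeFunctional (w : Heis P) (t : ℂ) : FreeForm P →ₗ[Env P] Heis P :=
  Finsupp.linearCombination (Env P) (genValue w t)

section FreeFunctional

variable (w : Heis P) (t : ℂ)

theorem freeFunctional_symD (a : Heis P) : freeFunctional w t (symD a) = ⁅w, a⁆ := by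
  simp [freeFunctional, symD, genValue]

theorem freeFunctional_symTheta : freeFunctional w t (symTheta P) = t • 1 := by
  simp [freeFunctional, symTheta, genValue]

theorem freeFunctional_freeL (a : Heis P) (ξ : FreeForm P) :
    freeFunctional w t (freeL a ξ) = a * freeFunctional w t ξ := by
  rw [freeL, map_smul, envL_smul]

theorem freeFunctional_freeR (a : Heis P) (ξ : FreeForm P) :
    freeFunctional w t (freeR ξ a) = freeFunctional w t ξ * a := by
  rw [freeR, map_smul, envR_smul]

theorem freeFunctional_freeComm (a : Heis P) (ξ : FreeForm P) :
    freeFunctional w t (freeComm ξ a) = ⁅freeFunctional w t ξ, a⁆ := by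
  rw [freeComm, map_sub, freeFunctional_freeL, freeFunctional_freeR, Ring.lie_def]

theorem freeFunctional_smul (c : ℂ) (ξ : FreeForm P) :
    freeFunctional w t (c • ξ) = c • freeFunctional w t ξ :=
  LinearMap.map_smul_of_tower _ c ξ

end FreeFunctional

theorem lie_mul {A : Type*} [Ring A] (a b c : A) : ⁅a, b * c⁆ = ⁅a, b⁆ * c + b * ⁅a, c⁆ := by
  simp only [Ring.lie_def]
  noncomm_ring

theorem mul_lie {A : Type*} [Ring A] (a b c : A) : ⁅a * b, c⁆ = ⁅a, c⁆ * b + a * ⁅b, c⁆ := by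
  simp only [Ring.lie_def]
  noncomm_ring

theorem InnerCompatible.freeFunctional_rel {w : Heis P} {t : ℂ} (h : InnerCompatible w t)
    {ξ : FreeForm P} (hξ : FormRel P ξ) : freeFunctional w t ξ = 0 := by
  induction hξ with
  | d_add a b => simp only [map_sub, map_add, freeFunctional_symD, lie_add, sub_self]
  | d_smul c a => simp only [map_sub, freeFunctional_smul, freeFunctional_symD, lie_smul, sub_self]
  | leibniz a b =>
    simp only [map_sub, map_add, freeFunctional_symD, freeFunctional_freeL, freeFunctional_freeR,
      lie_mul, sub_self]
  | theta_central a =>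
    rw [freeFunctional_freeComm, freeFunctional_symTheta, smul_lie, Ring.lie_def, mul_one,
      one_mul, sub_self, smul_zero]
  | d_fn f =>
    simp only [map_sub, map_sum, freeFunctional_smul, freeFunctional_symD, freeFunctional_freeL,
      freeFunctional_symTheta, mul_smul_comm, mul_one, sum_eta_smul, h.d_fn, smul_comm _ t,
      ← Finset.smul_sum]
    module
  | dx_fn a f =>
    simp only [map_sub, freeFunctional_smul, freeFunctional_freeComm, freeFunctional_symD,
      freeFunctional_freeL, freeFunctional_symTheta, mul_smul_comm, mul_one, sum_eta_smul, h.dx_fn]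
    module
  | dx_p a c =>
    simp only [map_sub, freeFunctional_smul, freeFunctional_freeComm, freeFunctional_symD,
      freeFunctional_freeL, freeFunctional_symTheta, mul_smul_comm, mul_one, sum_eta_smul, h.dx_p]
    module
  | dp_fn c f =>
    simp only [map_sub, map_sum, freeFunctional_smul, freeFunctional_freeComm,
      freeFunctional_symD, freeFunctional_freeL, freeFunctional_symTheta, mul_smul_comm, mul_one,
      sum_eta_smul, h.dp_fn, fnH_mul, smul_comm _ t, ← Finset.smul_sum]
    module
  | dp_p c d =>
    simp only [map_sub, map_sum, freeFunctional_smul, freeFunctional_freeComm,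
      freeFunctional_symD, freeFunctional_freeL, freeFunctional_symTheta, mul_smul_comm, mul_one,
      sum_eta_smul, h.dp_p, fnH_add, fnH_smul, fnH_mul, smul_comm _ t, ← Finset.smul_sum]
    module

/-- The bimodule map `Ω¹ → A` with `da ↦ [w, a]` and `θ' ↦ t`. -/
def InnerCompatible.functional {w : Heis P} {t : ℂ} (h : InnerCompatible w t) :
    BimoduleFunctional (Heis P) (Form P) where
  toLinearMap := ((formRelations P).liftQ (freeFunctional w t)
    (Submodule.span_le.2 fun _ => h.freeFunctional_rel)).restrictScalars ℂ
  map_lact' a ξ := by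
    obtain ⟨u, rfl⟩ := (formRelations P).mkQ_surjective ξ
    exact freeFunctional_freeL w t a u
  map_ract' ξ a := by
    obtain ⟨u, rfl⟩ := (formRelations P).mkQ_surjective ξ
    exact freeFunctional_freeR w t a u

theorem InnerCompatible.functional_d {w : Heis P} {t : ℂ} (h : InnerCompatible w t) (a : Heis P) :
    h.functional ((heisCalculus P).d a) = ⁅w, a⁆ :=
  freeFunctional_symD w t a

theorem InnerCompatible.functional_theta {w : Heis P} {t : ℂ} (h : InnerCompatible w t) :
    h.functional (θ P) = t • 1 :=
  freeFunctional_symTheta w t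

theorem InnerCompatible.smul {w : Heis P} {t : ℂ} (h : InnerCompatible w t) (s : ℂ) :
    InnerCompatible (s • w) (s * t) where
  d_fn f := by
    simp only [smul_lie, mul_smul_comm, h.d_fn, ← Finset.smul_sum]
    module
  dx_fn a f := by
    simp only [smul_lie, h.dx_fn]
    module
  dx_p a f := by
    simp only [smul_lie, h.dx_p]
    module
  dp_fn a f := by
    simp only [smul_lie, h.dp_fn]
    module
  dp_p a f := by
    simp only [smul_lie, mul_smul_comm, h.dp_p, ← Finset.smul_sum]
    module

/-! ## Brackets with positions, momenta and the Hamiltonian -/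

theorem fnH_lie_fnH (f g : P.Fn) : ⁅fnH f, fnH g⁆ = 0 := by
  rw [Ring.lie_def, fnH_comm, sub_self]

theorem fnH_lie_pH (f : P.Fn) (a : Fin 4) : ⁅fnH f, pH P a⁆ = (I * P.ħ) • fnH (P.pd a f) := by
  rw [Ring.lie_def, fnH_mul_pH, add_sub_cancel_left]

theorem pH_lie_fnH (f : P.Fn) (a : Fin 4) : ⁅pH P a, fnH f⁆ = -(I * P.ħ) • fnH (P.pd a f) := by
  rw [← lie_skew, fnH_lie_pH, neg_smul]

theorem pH_lie_pH (a b : Fin 4) : ⁅pH P a, pH P b⁆ = (I * P.ħ * P.qc) • fnH (P.F a b) := by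
  rw [Ring.lie_def, pH_mul_pH, add_sub_cancel_left]

theorem fnH_pd_coord (a b : Fin 4) : fnH (P.pd a (P.coord b)) = if a = b then 1 else 0 := by
  rw [pd_coord, apply_ite fnH, fnH_one, fnH_zero]

theorem innerCompatible_pH (b : Fin 4) : InnerCompatible (pH P b) 0 where
  d_fn f := by simp [xH, pH_lie_fnH, fnH_pd_coord]
  dx_fn a f := by simp [xH, pH_lie_fnH, fnH_lie_fnH]
  dx_p a c := by simp [xH, pH_lie_fnH, fnH_lie_pH, pd_pd_coord, fnH_zero]
  dp_fn c f := by simp [pH_lie_pH, fnH_lie_fnH]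
  dp_p c d := by simp [xH, pH_lie_pH, pH_lie_fnH, fnH_lie_pH, fnH_pd_coord, smul_smul, F1]

theorem innerCompatible_xH (b : Fin 4) : InnerCompatible (xH P b) 0 where
  d_fn f := by simp [xH, fnH_lie_fnH]
  dx_fn a f := by simp [xH, fnH_lie_fnH]
  dx_p a c := by simp [xH, fnH_lie_fnH]
  dp_fn c f := by simp [xH, fnH_lie_pH, fnH_lie_fnH]
  dp_p c d := by simp [xH, fnH_lie_pH, fnH_lie_fnH, pd_pd_coord, fnH_zero]

variable (P) in
/-- The Hamiltonian `η^{ab} p_a p_b / 2m`. -/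
def hamiltonian : Heis P := (1 / (2 * P.mc)) • ∑ a, eta a a • (pH P a * pH P a)

theorem hamiltonian_lie (b : Heis P) : ⁅hamiltonian P, b⁆
    = (1 / (2 * P.mc)) • ∑ a, eta a a • (⁅pH P a, b⁆ * pH P a + pH P a * ⁅pH P a, b⁆) := by
  simp only [hamiltonian, smul_lie, sum_lie, mul_lie]

theorem hamiltonian_lie_fnH (f : P.Fn) : ⁅hamiltonian P, fnH f⁆
    = -(I * P.ħ / (2 * P.mc)) • ∑ a, eta a a •
        ((2 : ℂ) • (fnH (P.pd a f) * pH P a) - (I * P.ħ) • fnH (P.pd a (P.pd a f))) := by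
  simp only [hamiltonian_lie, pH_lie_fnH, smul_mul_assoc, mul_smul_comm, pH_mul_fnH,
    Finset.smul_sum]
  refine Finset.sum_congr rfl fun a _ => ?_
  module

theorem hamiltonian_lie_xH (a : Fin 4) :
    ⁅hamiltonian P, xH P a⁆ = -(I * P.ħ / P.mc * eta a a) • pH P a := by
  have hm := P.m_ne'
  simp only [xH, hamiltonian_lie_fnH, pd_pd_coord, fnH_zero, fnH_pd_coord, ite_mul, one_mul,
    zero_mul, smul_zero, sub_zero, smul_ite, Finset.sum_ite_eq', Finset.mem_univ, if_true]
  match_scalars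
  field_simp

theorem hamiltonian_lie_pH (c : Fin 4) : ⁅hamiltonian P, pH P c⁆
    = (I * P.ħ * P.qc / (2 * P.mc)) • ∑ a, eta a a •
      ((2 : ℂ) • (fnH (P.F a c) * pH P a) - (I * P.ħ) • fnH (P.F1 a c a)) := by
  simp only [hamiltonian_lie, pH_lie_pH, smul_mul_assoc, mul_smul_comm, pH_mul_fnH, F1,
    Finset.smul_sum]
  refine Finset.sum_congr rfl fun a _ => ?_
  module

theorem innerCompatible_hamiltonian : InnerCompatible (hamiltonian P) (-(I * P.ħ)) where
  d_fn f := by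
    have hm := P.m_ne'
    simp only [hamiltonian_lie_fnH, hamiltonian_lie_xH, Finset.smul_sum, mul_smul_comm,
      ← Finset.sum_sub_distrib]
    refine Finset.sum_congr rfl fun a _ => ?_
    match_scalars <;> field_simp
  dx_fn a f := by
    rw [hamiltonian_lie_xH, smul_lie, pH_lie_fnH]
    module
  dx_p a c := by
    rw [hamiltonian_lie_xH, smul_lie, pH_lie_pH]
    module
  dp_fn c f := by
    simp only [hamiltonian_lie_pH, smul_lie, sum_lie, sub_lie, mul_lie, fnH_lie_fnH, pH_lie_fnH,
      mul_smul_comm, zero_mul, smul_zero, sub_zero, zero_add, Finset.smul_sum]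
    refine Finset.sum_congr rfl fun a _ => ?_
    module
  dp_p c d := by
    have hm := P.m_ne'
    simp only [hamiltonian_lie_pH, hamiltonian_lie_xH, smul_lie, sum_lie, sub_lie, mul_lie,
      fnH_lie_pH, pH_lie_pH, smul_mul_assoc, mul_smul_comm, Finset.smul_sum,
      ← Finset.sum_sub_distrib]
    refine Finset.sum_congr rfl fun a _ => ?_
    rw [← F1, ← F2]
    match_scalars
    · field_simp
    · ring
    · linear_combination (-(P.ħ ^ 3 * P.qc * I / (2 * P.mc) * eta a a)) * Complex.I_sq

/-! ## The central frame of the calculus -/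

theorem I_div_ħ_mul : I / P.ħ * (I * P.ħ) = -1 := by
  rw [div_mul_eq_mul_div, ← mul_assoc, Complex.I_mul_I, neg_one_mul, neg_div,
    div_self StateSpace.ħ_ne]

variable (P) in
/-- The coordinate `da ↦ (i/ħ) [p_b, a]`, `θ' ↦ 0` dual to `yForm P b`. -/
def coordY (b : Fin 4) : BimoduleFunctional (Heis P) (Form P) :=
  ((innerCompatible_pH b).smul (I / P.ħ)).functional

variable (P) in
/-- The coordinate `da ↦ -(i/ħ) [x^b, a]`, `θ' ↦ 0` dual to `zForm P b`. -/
def coordZ (b : Fin 4) : BimoduleFunctional (Heis P) (Form P) :=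
  ((innerCompatible_xH b).smul (-(I / P.ħ))).functional

variable (P) in
/-- The coordinate `da ↦ (i/ħ) [h, a]`, `θ' ↦ 1` dual to `θ'`, with `h` the Hamiltonian. -/
def coordT : BimoduleFunctional (Heis P) (Form P) :=
  (innerCompatible_hamiltonian.smul (I / P.ħ)).functional

theorem coordT_d (a : Heis P) :
    coordT P ((heisCalculus P).d a) = (I / P.ħ) • ⁅hamiltonian P, a⁆ :=
  (InnerCompatible.functional_d _ a).trans (smul_lie _ _ _)

theorem coordY_theta (b : Fin 4) : coordY P b (θ P) = 0 :=
  (InnerCompatible.functional_theta _).trans (by rw [mul_zero, zero_smul])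

theorem coordZ_theta (b : Fin 4) : coordZ P b (θ P) = 0 :=
  (InnerCompatible.functional_theta _).trans (by rw [mul_zero, zero_smul])

theorem coordT_theta : coordT P (θ P) = 1 :=
  (InnerCompatible.functional_theta _).trans (by rw [mul_neg, I_div_ħ_mul, neg_neg, one_smul])

theorem coordY_dx (b a : Fin 4) : coordY P b (dx P a) = if b = a then 1 else 0 :=
  (InnerCompatible.functional_d _ _).trans <| by
    rw [smul_lie, xH, pH_lie_fnH, smul_smul, mul_neg, I_div_ħ_mul, neg_neg, one_smul, fnH_pd_coord]

theorem coordY_dp (b c : Fin 4) : coordY P b (dp P c) = -P.qc • fnH (P.F b c) :=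
  (InnerCompatible.functional_d _ _).trans <| by
    rw [smul_lie, pH_lie_pH, smul_smul, ← mul_assoc, I_div_ħ_mul, neg_one_mul]

theorem coordZ_dx (b a : Fin 4) : coordZ P b (dx P a) = 0 :=
  (InnerCompatible.functional_d _ _).trans <| by rw [smul_lie, xH, xH, fnH_lie_fnH, smul_zero]

theorem coordZ_dp (b c : Fin 4) : coordZ P b (dp P c) = if c = b then 1 else 0 :=
  (InnerCompatible.functional_d _ _).trans <| by
    rw [smul_lie, xH, fnH_lie_pH, smul_smul, neg_mul, I_div_ħ_mul, neg_neg, one_smul, fnH_pd_coord]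

theorem coordT_dx (a : Fin 4) : coordT P (dx P a) = (eta a a / P.mc) • pH P a := by
  rw [dx, coordT_d, hamiltonian_lie_xH, smul_smul]
  congr 1
  linear_combination (-(eta a a / P.mc)) * (I_div_ħ_mul (P := P))

theorem coordT_dp (c : Fin 4) : coordT P (dp P c)
    = -(P.qc / (2 * P.mc)) • ∑ a, eta a a •
      ((2 : ℂ) • (fnH (P.F a c) * pH P a) - (I * P.ħ) • fnH (P.F1 a c a)) := by
  rw [dp, coordT_d, hamiltonian_lie_pH, smul_smul]
  congr 1
  linear_combination (P.qc / (2 * P.mc)) * (I_div_ħ_mul (P := P))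

variable (P) in
/-- The central form `y^a = dx^a - η^{ab} p_b θ' / m`. -/
def yForm (a : Fin 4) : Form P := dx P a - (eta a a / P.mc) • pH P a ▷ θ P

variable (P) in
/-- The central form `z_c = dp_c + q F_{ac} dx^a - (iħq/2m) η^{ab} F_{ac,b} θ'`. -/
def zForm (c : Fin 4) : Form P := dp P c + P.qc • ∑ a, fnH (P.F a c) ▷ dx P a
  - (I * P.ħ * P.qc / (2 * P.mc)) • ∑ a, eta a a • fnH (P.F1 a c a) ▷ θ P

theorem coordY_yForm (b a : Fin 4) : coordY P b (yForm P a) = if a = b then 1 else 0 := by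
  simp only [yForm, map_sub, map_smul, BimoduleFunctional.map_lact, coordY_dx, coordY_theta,
    mul_zero, smul_zero, sub_zero, eq_comm]

theorem coordZ_yForm (b a : Fin 4) : coordZ P b (yForm P a) = 0 := by
  simp only [yForm, map_sub, map_smul, BimoduleFunctional.map_lact, coordZ_dx, coordZ_theta,
    mul_zero, smul_zero, sub_zero]

theorem coordY_zForm (b c : Fin 4) : coordY P b (zForm P c) = 0 := by
  simp only [zForm, map_sub, map_add, map_smul, map_sum, BimoduleFunctional.map_lact, coordY_dp,
    coordY_dx, coordY_theta, mul_ite, mul_one, mul_zero, Finset.sum_ite_eq, Finset.mem_univ,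
    if_true, smul_zero, Finset.sum_const_zero, sub_zero]
  module

theorem coordZ_zForm (b c : Fin 4) : coordZ P b (zForm P c) = if c = b then 1 else 0 := by
  simp only [zForm, map_sub, map_add, map_smul, map_sum, BimoduleFunctional.map_lact, coordZ_dp,
    coordZ_dx, coordZ_theta, mul_zero, smul_zero, Finset.sum_const_zero, sub_zero, add_zero]

theorem coordT_yForm (a : Fin 4) : coordT P (yForm P a) = 0 := by
  rw [yForm, map_sub, map_smul, BimoduleFunctional.map_lact, coordT_theta, mul_one, coordT_dx,
    sub_self]

theorem coordT_zForm (c : Fin 4) : coordT P (zForm P c) = 0 := by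
  simp only [zForm, map_sub, map_add, map_smul, BimoduleFunctional.map_lact, coordT_dp,
    coordT_dx, coordT_theta, mul_smul_comm, mul_one, Fin.sum_univ_four]
  module

theorem isCentral_of_generators {ξ : Form P} (hfn : ∀ f : P.Fn, ξ ◁ fnH f = fnH f ▷ ξ)
    (hmom : ∀ a, ξ ◁ pH P a = pH P a ▷ ξ) : IsCentral ξ := by
  intro a
  induction a using Heis.induction with
  | const c => rw [Algebra.algebraMap_eq_smul_one, ract_smul, ract_one, smul_lact, one_lact]
  | fn f => exact hfn f
  | mom a => exact hmom a
  | add a b ha hb => rw [ract_add, add_lact, ha, hb]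
  | mul a b ha hb => rw [ract_mul, mul_lact, ha, ← lact_ract, hb]

theorem isCentral_yForm (a : Fin 4) : IsCentral (yForm P a) := by
  refine isCentral_of_generators (fun f => ?_) (fun c => ?_)
  · rw [yForm, sub_ract, smul_ract, ← lact_ract, isCentral_theta, dx_ract_fnH, ← mul_lact,
      pH_mul_fnH, lact_sub, lact_smul, sub_lact, mul_lact, smul_lact]
    module
  · rw [yForm, sub_ract, smul_ract, ← lact_ract, isCentral_theta, dx_ract_pH, ← mul_lact,
      pH_mul_pH, lact_sub, lact_smul, add_lact, mul_lact, smul_lact]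
    module

theorem isCentral_zForm (c : Fin 4) : IsCentral (zForm P c) := by
  refine isCentral_of_generators (fun f => ?_) (fun d => ?_)
  · simp only [zForm, sub_ract, add_ract, smul_ract, lact_sub, lact_add, lact_smul,
      ← lact_ract, isCentral_theta _, dx_ract_fnH, dp_ract_fnH, ← mul_lact, ← fnH_mul,
      mul_comm f, Fin.sum_univ_four]
    module
  · simp only [zForm, sub_ract, add_ract, smul_ract, lact_sub, lact_add, lact_smul,
      ← lact_ract, isCentral_theta _, dx_ract_pH, dp_ract_pH, ← mul_lact, fnH_mul_pH,
      add_lact, smul_lact, Fin.sum_univ_four, F1, F2]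
    module

variable (P) in
/-- The central forms `y^a`, `z_c`, `θ'`. -/
def frameVec : Fin 4 ⊕ Fin 4 ⊕ Unit → Form P :=
  Sum.elim (yForm P) (Sum.elim (zForm P) fun _ => θ P)

variable (P) in
/-- The coordinates with respect to `frameVec`. -/
def frameCoord : Fin 4 ⊕ Fin 4 ⊕ Unit → BimoduleFunctional (Heis P) (Form P) :=
  Sum.elim (coordY P) (Sum.elim (coordZ P) fun _ => coordT P)

theorem isCentral_frameVec (i : Fin 4 ⊕ Fin 4 ⊕ Unit) : IsCentral (frameVec P i) := by
  rcases i with a | c | _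
  exacts [isCentral_yForm a, isCentral_zForm c, isCentral_theta]

theorem frameCoord_frameVec (i j : Fin 4 ⊕ Fin 4 ⊕ Unit) :
    frameCoord P i (frameVec P j) = if j = i then 1 else 0 := by
  rcases i with b | b | _ <;> rcases j with a | c | _ <;>
    simp [frameCoord, frameVec, coordY_yForm, coordY_zForm, coordY_theta, coordZ_yForm,
      coordZ_zForm, coordZ_theta, coordT_yForm, coordT_zForm, coordT_theta]

theorem sum_frameCoord_lact_frameVec (ξ : Form P) :
    ∑ i, frameCoord P i ξ ▷ frameVec P i
      = ∑ a, coordY P a ξ ▷ yForm P a + ∑ c, coordZ P c ξ ▷ zForm P c + coordT P ξ ▷ θ P := by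
  simp [frameCoord, frameVec, add_assoc]

theorem frame_expand (ξ : Form P) : ∑ i, frameCoord P i ξ ▷ frameVec P i = ξ := by
  induction ξ using Form.induction with
  | add ξ ζ h h' => simp only [map_add, add_lact, Finset.sum_add_distrib, h, h']
  | lact a ξ h => simp only [BimoduleFunctional.map_lact, mul_lact, ← lact_sum, h]
  | ract a ξ h =>
    simp only [BimoduleFunctional.map_ract, mul_lact, ← isCentral_frameVec _ a, lact_ract,
      ← sum_ract, h]
  | theta =>
    simp only [sum_frameCoord_lact_frameVec, coordY_theta, coordZ_theta, coordT_theta, zero_lact,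
      one_lact, Finset.sum_const_zero, zero_add]
  | dx a =>
    simp only [sum_frameCoord_lact_frameVec, coordY_dx, coordZ_dx, coordT_dx, ite_lact, zero_lact,
      Finset.sum_ite_eq', Finset.mem_univ, if_true, Finset.sum_const_zero, add_zero, yForm,
      smul_lact, sub_add_cancel]
  | dp c =>
    simp only [sum_frameCoord_lact_frameVec, coordY_dp, coordZ_dp, coordT_dp, ite_lact,
      Finset.sum_ite_eq, Finset.mem_univ, if_true]
    simp only [yForm, zForm, lact_sub, lact_smul, sub_lact, smul_lact, mul_lact,
      Fin.sum_univ_four, add_lact]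
    module

variable (P) in
/-- The central frame `(y^a, z_c, θ')`. -/
def centralFrame : CentralFrame (Fin 4 ⊕ Fin 4 ⊕ Unit) (Heis P) (Form P) where
  vec := frameVec P
  coord := frameCoord P
  central := isCentral_frameVec
  expand := frame_expand
  coord_vec := frameCoord_frameVec

/-! ## The basis of exact forms and `θ'` over the algebra -/

/-- The one-form `u_a dx^a + v^c dp_c + w θ'` with coefficients `(u, v, w)`. -/
def combination (c : (Fin 4 → Heis P) × (Fin 4 → Heis P) × Heis P) : Form P :=
  ∑ a, c.1 a ▷ dx P a + ∑ a, c.2.1 a ▷ dp P a + c.2.2 ▷ θ P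

section Combination

variable (c : (Fin 4 → Heis P) × (Fin 4 → Heis P) × Heis P)

theorem coordZ_combination (b : Fin 4) : coordZ P b (combination c) = c.2.1 b := by
  simp [combination, BimoduleFunctional.map_lact, coordZ_dx, coordZ_dp, coordZ_theta]

theorem coordY_combination (b : Fin 4) : coordY P b (combination c)
    = c.1 b + ∑ a, c.2.1 a * coordY P b (dp P a) := by
  simp [combination, BimoduleFunctional.map_lact, coordY_dx, coordY_theta]

theorem coordT_combination : coordT P (combination c)
    = ∑ a, c.1 a * coordT P (dx P a) + ∑ a, c.2.1 a * coordT P (dp P a) + c.2.2 := by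
  simp [combination, BimoduleFunctional.map_lact, coordT_theta]

end Combination

-- The coordinates of `dx^a`, `dp_c`, `θ'` in the central frame form a unitriangular matrix.
theorem combination_injective : Function.Injective (combination (P := P)) := by
  intro c c' h
  have hdp : c.2.1 = c'.2.1 := funext fun b => by
    simpa only [coordZ_combination] using congrArg (coordZ P b) h
  have hdx : c.1 = c'.1 := funext fun b => by
    simpa only [coordY_combination, hdp, add_left_inj] using congrArg (coordY P b) h
  have htheta : c.2.2 = c'.2.2 := by
    simpa only [coordT_combination, hdp, hdx, add_right_inj] using congrArg (coordT P) h
  exact Prod.ext hdx (Prod.ext hdp htheta)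

theorem combination_surjective : Function.Surjective (combination (P := P)) := fun ξ => by
  refine ⟨(fun a => coordY P a ξ + P.qc • ∑ c, coordZ P c ξ * fnH (P.F a c),
    fun c => coordZ P c ξ, coordT P ξ - ∑ a, (eta a a / P.mc) • (coordY P a ξ * pH P a)
      - (I * P.ħ * P.qc / (2 * P.mc)) •
        ∑ c, ∑ a, eta a a • (coordZ P c ξ * fnH (P.F1 a c a))), ?_⟩
  conv_rhs => rw [← frame_expand ξ, sum_frameCoord_lact_frameVec]
  simp only [combination, yForm, zForm, lact_sub, lact_add, lact_smul, lact_sum, add_lact,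
    sub_lact, smul_lact, sum_lact, mul_lact, Finset.sum_add_distrib, Finset.sum_sub_distrib,
    ← Finset.smul_sum]
  rw [Finset.sum_comm (f := fun a c => coordZ P c ξ ▷ fnH (P.F a c) ▷ dx P a)]
  abel

theorem existsUnique_expansion (ξ : Form P) :
    ∃! c : (Fin 4 → Heis P) × (Fin 4 → Heis P) × Heis P,
      ξ = ∑ a, c.1 a ▷ dx P a + ∑ a, c.2.1 a ▷ dp P a + c.2.2 ▷ θ P := by
  simpa only [combination, eq_comm (a := ξ)] using
    Function.Bijective.existsUnique ⟨combination_injective, combination_surjective⟩ ξ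

/-! ## The connection on one-forms -/

theorem ħ_sq : P.ħ ^ 2 = -(I * P.ħ * (I * P.ħ)) := by
  linear_combination P.ħ ^ 2 * Complex.I_sq

variable (P) in
/-- The covariant derivatives of the frame: `∇y^d = -η^{dc} θ' ⊗ z_c / m`, `∇z_c = 0`,
`∇θ' = 0`. -/
def frameNabla : Fin 4 ⊕ Fin 4 ⊕ Unit → BTensor (Form P) (Form P) :=
  Sum.elim (fun d => -(eta d d / P.mc) • (θ P ⊠ zForm P d)) fun _ => 0

theorem isCentral_frameNabla (i : Fin 4 ⊕ Fin 4 ⊕ Unit) : IsCentral (frameNabla P i) := by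
  rcases i with d | _
  exacts [(isCentral_theta.tmul (isCentral_zForm d)).smul _, .zero]

variable (P) in
/-- The connection `∇` of the theorem: its braiding flips the central frame, whose covariant
derivatives are `frameNabla`. -/
def formConnection : BimoduleConnection (heisCalculus P) (heisCalculus P) (Form P) :=
  (centralFrame P).connection (heisCalculus P) (frameNabla P) isCentral_frameNabla

theorem nabla_yForm (d : Fin 4) :
    (formConnection P).nabla (yForm P d) = -(eta d d / P.mc) • (θ P ⊠ zForm P d) :=
  (centralFrame P).nabla_vec _ _ (Sum.inl d)

theorem nabla_zForm (c : Fin 4) : (formConnection P).nabla (zForm P c) = 0 :=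
  (centralFrame P).nabla_vec _ _ (Sum.inr (Sum.inl c))

theorem nabla_theta : (formConnection P).nabla (θ P) = 0 :=
  (centralFrame P).nabla_vec _ _ (Sum.inr (Sum.inr ()))

theorem sigma_lact (a : Heis P) (ξ ζ : Form P) :
    (formConnection P).sigma ((a ▷ ξ) ⊠ ζ) = a ▷ (formConnection P).sigma (ξ ⊠ ζ) := by
  rw [← (formConnection P).sigma_left, lact_tmul]

theorem sigma_central_left {ξ : Form P} (h : IsCentral ξ) (ζ : Form P) :
    (formConnection P).sigma (ξ ⊠ ζ) = ζ ⊠ ξ := (centralFrame P).flip_central_left h ζ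

theorem sigma_central_right (ξ : Form P) {ζ : Form P} (h : IsCentral ζ) :
    (formConnection P).sigma (ξ ⊠ ζ) = ζ ⊠ ξ := (centralFrame P).flip_central_right ξ h

theorem dx_eq (a : Fin 4) : dx P a = yForm P a + (eta a a / P.mc) • pH P a ▷ θ P := by
  rw [yForm, sub_add_cancel]

theorem dp_eq (c : Fin 4) : dp P c = zForm P c - P.qc • ∑ a, fnH (P.F a c) ▷ dx P a
    + (I * P.ħ * P.qc / (2 * P.mc)) • ∑ a, eta a a • fnH (P.F1 a c a) ▷ θ P := by
  rw [zForm]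
  abel

theorem nabla_dx (d : Fin 4) : (formConnection P).nabla (dx P d) =
    -((P.qc / P.mc) • ∑ a, ∑ c, eta c d • (fnH (P.F a c) ▷ (θ P ⊠ dx P a)))
      + θ P ⊠ ((I * P.ħ * P.qc / (2 * P.mc ^ 2)) •
          ∑ a, ∑ b, ∑ c, (eta a b * eta c d) • (fnH (P.F1 b c a) ▷ θ P)) := by
  have hp : (formConnection P).nabla (pH P d ▷ θ P) = θ P ⊠ dp P d := by
    rw [(formConnection P).left_leibniz, nabla_theta, lact_zero, zero_add,
      sigma_central_right _ isCentral_theta, dp]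
  rw [dx_eq, map_add, map_smul, nabla_yForm, hp, dp_eq]
  simp only [mul_smul, sum_eta_smul, sum_eta_smul', ← Finset.smul_sum, tmul_add, tmul_sub,
    tmul_smul, tmul_sum, isCentral_theta.tmul_lact]
  simp only [Fin.sum_univ_four]
  module

theorem sigma_dx (a : Fin 4) (ζ : Form P) : (formConnection P).sigma (dx P a ⊠ ζ) =
    ζ ⊠ dx P a + (eta a a / P.mc) • ((pH P a ▷ ζ - ζ ◁ pH P a) ⊠ θ P) := by
  rw [dx_eq a, add_tmul, smul_tmul, map_add, map_smul, sigma_lact,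
    sigma_central_left isCentral_theta, sigma_central_left (isCentral_yForm a), tmul_add,
    tmul_smul, ← tmul_balanced, sub_tmul, lact_tmul]
  module

theorem sigma_dp (c : Fin 4) (ζ : Form P) : (formConnection P).sigma (dp P c ⊠ ζ) =
    ζ ⊠ zForm P c - P.qc • ∑ a, fnH (P.F a c) ▷ (formConnection P).sigma (dx P a ⊠ ζ)
      + (I * P.ħ * P.qc / (2 * P.mc)) • ∑ a, eta a a • fnH (P.F1 a c a) ▷ (ζ ⊠ θ P) := by
  rw [dp_eq c]
  simp only [add_tmul, sub_tmul, smul_tmul, sum_tmul, map_add, map_sub, map_sum, map_smul,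
    sigma_lact, sigma_central_left isCentral_theta, sigma_central_left (isCentral_zForm c)]

theorem sigma_dx_dx (e d : Fin 4) : (formConnection P).sigma (dx P e ⊠ dx P d) =
    dx P d ⊠ dx P e + (I * P.ħ * P.qc / P.mc ^ 2) •
      ∑ a, ∑ c, (eta c d * eta a e) • (fnH (P.F a c) ▷ (θ P ⊠ θ P)) := by
  simp only [mul_smul, sum_eta_smul', ← Finset.smul_sum]
  rw [sigma_dx, dx_ract_pH, F_antisymm d e, fnH_neg, neg_lact, sub_add_cancel_left, neg_tmul,
    smul_tmul, neg_tmul, lact_tmul]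
  module

theorem sigma_dp_dx (e d : Fin 4) : (formConnection P).sigma (dp P e ⊠ dx P d) =
    dx P d ⊠ dp P e + (I * P.ħ * P.qc / P.mc) • ∑ c, eta d c • (θ P ⊠
      (-(∑ a, fnH (P.F1 a e c) ▷ dx P a)
        - (P.qc / P.mc) • (∑ a, ∑ b, eta a b • (fnH (P.F a c * P.F b e) ▷ θ P))
        + (I * P.ħ / (2 * P.mc)) • ∑ a, ∑ b, eta a b • (fnH (P.F2 a e c b) ▷ θ P))) := by
  simp only [sigma_dp, sigma_dx_dx, mul_smul, sum_eta_smul, sum_eta_smul', ← Finset.smul_sum]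
  simp only [zForm, sub_tmul, smul_tmul, tmul_add, tmul_sub, tmul_neg, tmul_smul, tmul_sum,
    isCentral_theta.tmul_lact, ← tmul_balanced, dx_ract_fnH, ← lact_tmul, lact_add, lact_smul,
    ← mul_lact, ← fnH_mul, mul_comm (P.F _ d)]
  simp only [P.F2_comm _ e d _]
  simp only [F1, F2, Fin.sum_univ_four]
  module

theorem sigma_dx_dp (a c : Fin 4) : (formConnection P).sigma (dx P a ⊠ dp P c) =
    dp P c ⊠ dx P a
      + (I * P.ħ * P.qc / P.mc) • (∑ d, ∑ e, eta e a • (fnH (P.F1 d c e) ▷ (dx P d ⊠ θ P)))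
      - ((I * P.ħ * P.qc ^ 2 / P.mc ^ 2) •
            (∑ b, ∑ n, ∑ r, (eta b n * eta r a) • (fnH (P.F n c * P.F r b) ▷ (θ P ⊠ θ P)))
          - (P.ħ ^ 2 * P.qc / (2 * P.mc ^ 2)) •
            ∑ b, ∑ n, ∑ r, (eta a r * eta n b) • (fnH (P.F2 b c n r) ▷ (θ P ⊠ θ P))) := by
  simp only [mul_smul, sum_eta_smul, sum_eta_smul', ← Finset.smul_sum]
  rw [sigma_dx, dp_ract_pH, ħ_sq]
  simp only [add_tmul, sub_tmul, smul_tmul, P.F_antisymm a, fnH_mul, fnH_neg, mul_neg,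
    neg_lact, ← lact_tmul, Fin.sum_univ_four]
  module

theorem sigma_dp_dp (e d : Fin 4) : (formConnection P).sigma (dp P e ⊠ dp P d) =
    dp P d ⊠ dp P e
      + (I * P.ħ * P.qc ^ 2 / P.mc) • (∑ r, ∑ p, ∑ a, eta r p •
          (fnH (P.F r d * P.F1 a e p) ▷ (θ P ⊠ dx P a)
            - fnH (P.F r e * P.F1 a d p) ▷ (dx P a ⊠ θ P)))
      + (I * P.ħ * P.qc ^ 3 / P.mc ^ 2) • (∑ r, ∑ p, ∑ a, ∑ b, (eta r p * eta b a) •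
          (fnH (P.F p e * P.F a d * P.F r b) ▷ (θ P ⊠ θ P)))
      + (P.ħ ^ 2 * P.qc ^ 2 / (2 * P.mc ^ 2)) • (∑ r, ∑ p, ∑ a, ∑ b, (eta r p * eta a b) •
          (fnH (P.F p d * P.F2 b e a r - P.F2 p d a r * P.F b e) ▷ (θ P ⊠ θ P))) := by
  rw [ħ_sq, sigma_dp]
  simp only [sigma_dx_dp, mul_smul, sum_eta_smul, sum_eta_smul', ← Finset.smul_sum]
  simp only [ħ_sq, zForm, add_tmul, smul_tmul, sum_tmul, tmul_add, tmul_sub, tmul_smul,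
    tmul_sum, ← tmul_balanced, dp_ract_fnH, ← lact_tmul, lact_add, lact_sub, lact_smul, lact_sum,
    ← mul_lact, ← fnH_mul, fnH_sub, sub_lact]
  simp only [Fin.sum_univ_four, mul_comm (P.F2 _ d _ _), P.F2_comm _ d]
  simp only [← mul_assoc, F1, F2]
  module

theorem nabla_fnH_lact (f : P.Fn) (ξ : Form P) : (formConnection P).nabla (fnH f ▷ ξ)
    = fnH f ▷ (formConnection P).nabla ξ
      + (∑ a, fnH (P.pd a f) ▷ (formConnection P).sigma (dx P a ⊠ ξ)
        - (I * P.ħ / (2 * P.mc)) • ∑ a, eta a a • fnH (P.pd a (P.pd a f)) ▷ (ξ ⊠ θ P)) := by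
  rw [(formConnection P).left_leibniz, d_fnH]
  simp only [sub_tmul, sum_tmul, smul_tmul, map_sub, map_sum, map_smul, sigma_lact,
    sigma_central_left isCentral_theta]

theorem nabla_dp (c : Fin 4) : (formConnection P).nabla (dp P c) =
    -(P.qc • ∑ d, ∑ e, fnH (P.F1 d c e) ▷ (dx P d ⊠ dx P e))
      - xiForm P c ⊠ θ P - θ P ⊠ etaForm P c + fnH (Ncoef P c) ▷ (θ P ⊠ θ P) := by
  have hcoef : P.ħ ^ 2 * P.qc / (4 * P.mc ^ 2)
      = -(I * P.ħ * P.qc / (2 * P.mc) * (I * P.ħ / (2 * P.mc))) := by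
    linear_combination (P.ħ ^ 2 * P.qc / (4 * P.mc ^ 2)) * Complex.I_sq
  rw [xiForm, etaForm, Ncoef, hcoef, dp_eq]
  simp only [map_add, map_sub, map_smul, map_sum, nabla_zForm, nabla_fnH_lact, nabla_dx,
    nabla_theta, sigma_dx_dx, sigma_central_right _ isCentral_theta, lact_zero]
  simp only [mul_smul, sum_eta_smul, sum_eta_smul', ← Finset.smul_sum, ← neg_smul]
  simp only [tmul_sub, smul_tmul, sum_tmul, tmul_smul, tmul_sum, isCentral_theta.tmul_lact,
    ← lact_tmul, lact_add, lact_smul, lact_sum, ← mul_lact, ← fnH_mul, fnH_add, fnH_smul, fnH_sum,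
    add_lact, smul_lact, sum_lact, smul_add, mul_comm (P.pd _ (P.F _ c)), mul_comm (P.F _ c)]
  simp only [F1, F2, F3, Fin.sum_univ_four]
  module

/-! ## The Klein–Gordon connection -/

section TimeDerivative

variable {φ : ℝ × Spacetime → ℂ}

theorem timeD_mul_of_space {g : Spacetime → ℂ} (hg : Differentiable ℝ g)
    (hφ : Differentiable ℝ φ) (z : ℝ × Spacetime) :
    timeD (fun z => g z.2 * φ z) z = g z.2 * timeD φ z := by
  have hg' : HasFDerivAt (fun z : ℝ × Spacetime => g z.2)
      ((fderiv ℝ g z.2).comp (ContinuousLinearMap.snd ℝ ℝ Spacetime)) z :=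
    (hg z.2).hasFDerivAt.comp z hasFDerivAt_snd
  simp [timeD, (hg'.fun_mul (hφ z).hasFDerivAt).fderiv]

theorem timeD_mul_of_time {b : ℝ → ℂ} (hb : Differentiable ℝ b) (hφ : Differentiable ℝ φ)
    (z : ℝ × Spacetime) :
    timeD (fun z => b z.1 * φ z) z = b z.1 * timeD φ z + deriv b z.1 * φ z := by
  have hb' : HasFDerivAt (fun z : ℝ × Spacetime => b z.1)
      ((fderiv ℝ b z.1).comp (ContinuousLinearMap.fst ℝ ℝ Spacetime)) z :=
    (hb z.1).hasFDerivAt.comp z hasFDerivAt_fst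
  simp [timeD, (hb'.fun_mul (hφ z).hasFDerivAt).fderiv, mul_comm (φ z)]

theorem timeD_covD (a : Fin 4) (hφ : ContDiff ℝ 2 φ) (z : ℝ × Spacetime) :
    timeD (covD P a φ) z = covD P a (timeD φ) z := by
  have hpot : Differentiable ℝ fun y => I * (P.qc / P.ħ) * (P.pot a y : ℂ) :=
    ((Complex.ofRealCLM.contDiff.comp (P.pot_smooth a)).differentiable (by simp)).const_mul _
  have hφ₁ : Differentiable ℝ φ := hφ.differentiable (by simp)
  have hφ₂ : Differentiable ℝ fun y => fderiv ℝ φ y (0, Pi.single a 1) :=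
    ((hφ.fderiv_right (m := 1) (by norm_num)).clm_apply contDiff_const).differentiable (by simp)
  have hmul := timeD_mul_of_space hpot hφ₁ z
  have hpot' : Differentiable ℝ fun z : ℝ × Spacetime => I * (P.qc / P.ħ) * (P.pot a z.2 : ℂ) :=
    hpot.comp differentiable_snd
  have hsub : fderiv ℝ (covD P a φ) z = _ := fderiv_fun_sub (hφ₂ z) ((hpot' z).mul (hφ₁ z))
  rw [timeD, hsub, sub_apply, fderiv_fderiv_apply_comm hφ]
  exact congrArg _ hmul

end TimeDerivative

theorem isCentral_ds : IsCentral ds := fun _ => rfl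

theorem lact_ds (b : Line) : b ▷ ds = toForm b := by rw [ds, lact_toForm, mul_one]

theorem lineConnection_nabla_ds : lineConnection.nabla ds = 0 := by
  change toForm (Line.deriv 1) ⊠ ds = 0
  have h : toForm (Line.deriv 1) = 0 := lineCalculus.d_one
  rw [h, zero_tmul]

theorem coordT_dp_eq_Xdp (c : Fin 4) : coordT P (dp P c) = Xdp P c := by
  simp only [coordT_dp, Xdp, sum_eta_smul, P.F_antisymm c, P.F1_antisymm c, fnH_neg, neg_mul,
    smul_neg, Finset.smul_sum]
  refine Finset.sum_congr rfl fun a _ => ?_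
  module

theorem square_coordT_frameNabla (i : Fin 4 ⊕ Fin 4 ⊕ Unit) :
    (coordT P).square (frameNabla P i) = 0 := by
  rcases i with d | _
  · change (coordT P).square (-(eta d d / P.mc) • (θ P ⊠ zForm P d)) = 0
    rw [map_smul, BimoduleFunctional.square_tmul, coordT_zForm, mul_zero, smul_zero]
  · exact map_zero _

namespace StateSpace

variable (E : StateSpace P)

theorem rep_fnH (f : P.Fn) : E.rep (fnH f) = E.mulFn f := by
  rw [fnH, rep_mk, FreeAlgebra.lift_ι_apply, Sum.elim_inl]

theorem rep_pH (a : Fin 4) : E.rep (pH P a) = -(I * P.ħ) • E.D a := by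
  rw [pH, rep_mk, FreeAlgebra.lift_ι_apply, Sum.elim_inr]

theorem dds_mulFn (f : P.Fn) : E.dds * E.mulFn f = E.mulFn f * E.dds := by
  ext φ z
  exact timeD_mul_of_space (differentiable_fn f) (E.diff φ) z

theorem dds_mulLine (b : Line) :
    E.dds * E.mulLine b = E.mulLine b * E.dds + E.mulLine (Line.deriv b) := by
  have hb : ContDiff ℝ ∞ b.1 := b.2
  ext φ z
  exact timeD_mul_of_time (hb.differentiable (by simp)) (E.diff φ) z

theorem dds_D (a : Fin 4) : E.dds * E.D a = E.D a * E.dds := by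
  ext φ z
  exact timeD_covD a ((E.smooth φ.1 φ.2).of_le ENat.LEInfty.out) z

theorem dds_rep (a : Heis P) : E.dds * E.rep a = E.rep a * E.dds := by
  induction a using Heis.induction with
  | const c => rw [AlgHom.commutes, Algebra.commutes]
  | fn f => rw [rep_fnH, dds_mulFn]
  | mom a => rw [rep_pH, mul_smul_comm, dds_D, smul_mul_assoc]
  | add a b ha hb => rw [map_add, mul_add, add_mul, ha, hb]
  | mul a b ha hb => rw [map_mul, ← mul_assoc, ha, mul_assoc, hb, mul_assoc]

theorem kleinGordon_eq : E.kleinGordon = E.dds + E.rep ((I / P.ħ) • hamiltonian P) := by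
  have hħ := ħ_ne (P := P)
  have hsq (a : Fin 4) : E.rep (pH P a * pH P a) = -P.ħ ^ 2 • (E.D a * E.D a) := by
    rw [map_mul, rep_pH, smul_mul_smul_comm, neg_mul_neg, neg_eq_iff_eq_neg.2 ħ_sq]
  simp only [kleinGordon, hamiltonian, map_smul, map_sum, hsq, sum_eta_smul, smul_comm (eta _ _),
    ← Finset.smul_sum]
  match_scalars <;> field_simp

theorem kleinGordon_rep (a : Heis P) : E.kleinGordon * E.rep a
    = E.rep a * E.kleinGordon + E.rep (coordT P ((heisCalculus P).d a)) := by
  rw [kleinGordon_eq, coordT_d, ← smul_lie, Ring.lie_def, add_mul, mul_add, dds_rep, map_sub,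
    map_mul, map_mul]
  abel

theorem kleinGordon_mulLine (b : Line) : E.kleinGordon * E.mulLine b
    = E.mulLine b * E.kleinGordon + E.mulLine (Line.deriv b) := by
  rw [kleinGordon_eq, add_mul, mul_add, dds_mulLine, rep_mulLine]
  abel

/-- The Klein–Gordon operator as the evolution along the `θ'`-coordinate functional. -/
def evolution : EvolutionOperator (heisCalculus P) lineCalculus (coordT P) ds E.space where
  toLinearMap := E.kleinGordon
  map_lact' a φ := LinearMap.congr_fun (E.kleinGordon_rep a) φ
  map_ract' φ b := by
    have h : E.kleinGordon (φ ◁ b) = E.kleinGordon φ ◁ b + φ ◁ Line.deriv b :=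
      LinearMap.congr_fun (E.kleinGordon_mulLine b) φ
    change E.kleinGordon (φ ◁ b) ⊠ ds = (E.kleinGordon φ ◁ b) ⊠ ds + φ ⊠ toForm (Line.deriv b)
    rw [h, add_tmul, tmul_balanced φ, lact_ds (Line.deriv b)]

/-- The bimodule connection with `∇_E φ = (∂_s φ - (iħ/2m) η^{ab} D_a D_b φ) ⊗ ds` and
`σ_E(ξ ⊗ φ) = X(ξ) φ ⊗ ds` for the `θ'`-coordinate `X`. -/
def connection : BimoduleConnection (heisCalculus P) lineCalculus E.space :=
  E.evolution.connection isCentral_ds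

theorem connection_nabla : E.connection.nabla = E.nablaE := rfl

theorem connection_sigma_tmul (ξ : Form P) (φ : E.space) :
    E.connection.sigma (ξ ⊠ φ) = (coordT P ξ ▷ φ) ⊠ ds :=
  E.evolution.connection_sigma_tmul isCentral_ds ξ φ

theorem sigma_theta (φ : E.space) : E.connection.sigma (θ P ⊠ φ) = φ ⊠ ds := by
  rw [connection_sigma_tmul, coordT_theta, one_lact]

theorem sigma_dx (a : Fin 4) (φ : E.space) : E.connection.sigma (dx P a ⊠ φ)
    = (-(I * P.ħ / P.mc) • ∑ b, eta a b • E.D b φ) ⊠ ds := by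
  have hp : pH P a ▷ φ = -(I * P.ħ) • E.D a φ := LinearMap.congr_fun (E.rep_pH a) φ
  rw [connection_sigma_tmul, coordT_dx, smul_lact, hp, sum_eta_smul, smul_smul, smul_smul]
  ring_nf

theorem sigma_dp (c : Fin 4) (φ : E.space) :
    E.connection.sigma (dp P c ⊠ φ) = (Xdp P c ▷ φ) ⊠ ds := by
  rw [connection_sigma_tmul, coordT_dp_eq_Xdp]

theorem doubleNabla_eq_zero : doubleNabla (formConnection P) lineConnection E.connection = 0 :=
  E.evolution.doubleNabla_eq_zero isCentral_ds _ _ lineConnection_nabla_ds rfl fun ξ =>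
    (centralFrame P).square_coord_nabla (heisCalculus P) (j := Sum.inr (Sum.inr ()))
      square_coordT_frameNabla ξ

end StateSpace

end QGeo

end

theorem theorem5p2 (P : Background) :
    (∀ ξ : Form P, ∃! c : (Fin 4 → Heis P) × (Fin 4 → Heis P) × Heis P,
      ξ = ∑ a, c.1 a ▷ dx P a + ∑ a, c.2.1 a ▷ dp P a + c.2.2 ▷ θ P) ∧
    ∃ cA : BimoduleConnection (heisCalculus P) (heisCalculus P) (Form P),
      cA.nabla (θ P) = 0 ∧
      (∀ d, cA.nabla (dx P d) =
        -((P.qc / P.mc) • ∑ a, ∑ c, eta c d • (fnH (P.F a c) ▷ (θ P ⊠ dx P a)))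
          + θ P ⊠ ((I * P.ħ * P.qc / (2 * P.mc ^ 2)) •
              ∑ a, ∑ b, ∑ c, (eta a b * eta c d) • (fnH (P.F1 b c a) ▷ θ P))) ∧
      (∀ c, cA.nabla (dp P c) =
        -(P.qc • ∑ d, ∑ e, fnH (P.F1 d c e) ▷ (dx P d ⊠ dx P e))
          - xiForm P c ⊠ θ P - θ P ⊠ etaForm P c + fnH (Ncoef P c) ▷ (θ P ⊠ θ P)) ∧
      (∀ ξ, cA.sigma (θ P ⊠ ξ) = ξ ⊠ θ P) ∧
      (∀ ξ, cA.sigma (ξ ⊠ θ P) = θ P ⊠ ξ) ∧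
      (∀ e d, cA.sigma (dx P e ⊠ dx P d) = dx P d ⊠ dx P e
        + (I * P.ħ * P.qc / P.mc ^ 2) •
            ∑ a, ∑ c, (eta c d * eta a e) • (fnH (P.F a c) ▷ (θ P ⊠ θ P))) ∧
      (∀ e d, cA.sigma (dp P e ⊠ dx P d) = dx P d ⊠ dp P e
        + (I * P.ħ * P.qc / P.mc) • ∑ c, eta d c • (θ P ⊠
            (-(∑ a, fnH (P.F1 a e c) ▷ dx P a)
              - (P.qc / P.mc) • (∑ a, ∑ b, eta a b • (fnH (P.F a c * P.F b e) ▷ θ P))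
              + (I * P.ħ / (2 * P.mc)) • ∑ a, ∑ b, eta a b • (fnH (P.F2 a e c b) ▷ θ P)))) ∧
      (∀ a c, cA.sigma (dx P a ⊠ dp P c) = dp P c ⊠ dx P a
        + (I * P.ħ * P.qc / P.mc) •
            (∑ d, ∑ e, eta e a • (fnH (P.F1 d c e) ▷ (dx P d ⊠ θ P)))
        - ((I * P.ħ * P.qc ^ 2 / P.mc ^ 2) •
              (∑ b, ∑ n, ∑ r, (eta b n * eta r a) • (fnH (P.F n c * P.F r b) ▷ (θ P ⊠ θ P)))
            - (P.ħ ^ 2 * P.qc / (2 * P.mc ^ 2)) •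
              ∑ b, ∑ n, ∑ r, (eta a r * eta n b) • (fnH (P.F2 b c n r) ▷ (θ P ⊠ θ P)))) ∧
      (∀ e d, cA.sigma (dp P e ⊠ dp P d) = dp P d ⊠ dp P e
        + (I * P.ħ * P.qc ^ 2 / P.mc) • (∑ r, ∑ p, ∑ a, eta r p •
            (fnH (P.F r d * P.F1 a e p) ▷ (θ P ⊠ dx P a)
              - fnH (P.F r e * P.F1 a d p) ▷ (dx P a ⊠ θ P)))
        + (I * P.ħ * P.qc ^ 3 / P.mc ^ 2) • (∑ r, ∑ p, ∑ a, ∑ b, (eta r p * eta b a) •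
            (fnH (P.F p e * P.F a d * P.F r b) ▷ (θ P ⊠ θ P)))
        + (P.ħ ^ 2 * P.qc ^ 2 / (2 * P.mc ^ 2)) • (∑ r, ∑ p, ∑ a, ∑ b, (eta r p * eta a b) •
            (fnH (P.F p d * P.F2 b e a r - P.F2 p d a r * P.F b e) ▷ (θ P ⊠ θ P)))) ∧
      ∀ E : StateSpace P, ∃ cE : BimoduleConnection (heisCalculus P) lineCalculus E.space,
        cE.nabla = E.nablaE ∧
        (∀ φ, cE.sigma (θ P ⊠ φ) = φ ⊠ ds) ∧
        (∀ a φ, cE.sigma (dx P a ⊠ φ) =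
          (-(I * P.ħ / P.mc) • ∑ b, eta a b • E.D b φ) ⊠ ds) ∧
        (∀ c φ, cE.sigma (dp P c ⊠ φ) = (Xdp P c ▷ φ) ⊠ ds) ∧
        doubleNabla cA lineConnection cE = 0 := by
  refine ⟨existsUnique_expansion, formConnection P, nabla_theta, nabla_dx, nabla_dp,
    sigma_central_left isCentral_theta, fun ξ => sigma_central_right ξ isCentral_theta,
    sigma_dx_dx, sigma_dp_dx, sigma_dx_dp, sigma_dp_dp, fun E => ?_⟩
  exact ⟨E.connection, E.connection_nabla, E.sigma_theta, E.sigma_dx, E.sigma_dp,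
    E.doubleNabla_eq_zero⟩
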